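/- **Theorem 1.2.** Let $\lambda\in\mathbb R$, $0<T\le\infty$, and let $u\in C^0([0,T);H^3(\mathbb R))\cap C^1([0,T);H^2(\mathbb R))$ be a solution of the Cauchy problem $$u_t-u_{txx}+\lambda(u-u_{xx})+3u^2u_x=u\,u_{xxx}+2u_xu_{xx},\qquad u(0,x)=u_0(x)$$ (the equation holding in $L^2(\mathbb R)$ for every $t\in[0,T)$). Put $m_0=u_0-u_0''$, and assume that $m_0\in H^1(\mathbb R)$ and that there is a constant $k>0$ such that $u_x(t,x)>-k$ for every $t\in[0,T)$ and almost every $x\in\mathbb R$. Then there exists a constant $\kappa>0$ such that $$\|u(t)\|_{H^3(\mathbb R)}\le e^{\kappa t}\,\|m_0\|_{H^1(\mathbb R)}\qquad\text{for all } t\in[0,T).$$ In particular, $u$ does not blow up in finite time: it is not the case that $T<\infty$ and $\limsup_{t\to T^-}\|u(t)\|_{H^3(\mathbb R)}=\infty$. Here $\|f\|_{H^n(\mathbb R)}=\|(1-\partial_x^2)^{n/2}f\|_{L^2(\mathbb R)}$, that is, $\|f\|_{H^n(\mathbb R)}^2=\sum_{j=0}^n\binom nj\|\partial_x^jf\|_{L^2(\mathbb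 R)}^2$. -/

import Mathlib

open MeasureTheory Filter Topology
open scoped ContDiff

/-- `g` is the weak (distributional) derivative of `f` on the real line:
`∫ f φ' = - ∫ g φ` for every smooth compactly supported test function `φ`. -/
def HasWeakDeriv (f g : ℝ → ℝ) : Prop :=
  LocallyIntegrable f volume ∧ LocallyIntegrable g volume ∧
    ∀ φ : ℝ → ℝ, ContDiff ℝ ∞ φ → HasCompactSupport φ →
      ∫ x, f x * deriv φ x = - ∫ x, g x * φ x

open Classical in
/-- The weak derivative of `f` (a representative of it, which is unique almost everywhere),
and `0` if `f` has none. -/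
noncomputable def weakDeriv (f : ℝ → ℝ) : ℝ → ℝ :=
  if h : ∃ g, HasWeakDeriv f g then Classical.choose h else 0

/-- Membership in the Sobolev space `H^n(ℝ)`: the function is in `L²` and has weak derivatives
in `L²` up to the order `n`. -/
def MemSobolevH : ℕ → (ℝ → ℝ) → Prop
  | 0, f => MemLp f 2 volume
  | n + 1, f => MemLp f 2 volume ∧ ∃ g, HasWeakDeriv f g ∧ MemSobolevH n g

/-- The norm of `H^n(ℝ)`, used for functions with `MemSobolevH n f`: with `f⁽ʲ⁾` the weak
derivatives, `‖f‖² = ∑ j ≤ n, (n choose j) ‖f⁽ʲ⁾‖²_{L²}`. By Plancherel's theorem and the binomial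
formula this is `∫ (1 + ξ²)ⁿ |f̂(ξ)|² dξ`, that is `‖(1 - ∂ₓ²)^{n/2} f‖²_{L²}`. -/
noncomputable def sobolevNorm (n : ℕ) (f : ℝ → ℝ) : ℝ :=
  Real.sqrt (∑ j ∈ Finset.range (n + 1),
    (n.choose j : ℝ) * ∫ x, (weakDeriv^[j] f x) ^ 2)

/-- The time interval `[0, T)`, where `T` may be `∞`. -/
def timeInterval (T : EReal) : Set ℝ := {t : ℝ | 0 ≤ t ∧ (t : EReal) < T}

/-- `u ∈ C⁰(I; H^n(ℝ))`. -/
def ContinuousInSobolev (n : ℕ) (I : Set ℝ) (u : ℝ → ℝ → ℝ) : Prop :=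
  (∀ t ∈ I, MemSobolevH n (u t)) ∧
    ∀ s ∈ I, Tendsto (fun t => sobolevNorm n (fun x => u t x - u s x)) (𝓝[I] s) (𝓝 0)

/-- For every `s ∈ I`, `v s` is the derivative at time `s` of the curve `t ↦ u t` on `I`
with respect to the norm of `H^n(ℝ)` (one-sided at an end point of `I`). -/
def HasTimeDerivInSobolev (n : ℕ) (I : Set ℝ) (u v : ℝ → ℝ → ℝ) : Prop :=
  ∀ s ∈ I, Tendsto (fun t => sobolevNorm n (fun x => (u t x - u s x) / (t - s) - v s x))
    (𝓝[I \ {s}] s) (𝓝 0)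

/-- `u` (written `u t x`) belongs to `C⁰([0,T); H³(ℝ)) ∩ C¹([0,T); H²(ℝ))` and solves
the Cauchy problem
`u_t - u_txx + lam (u - u_xx) + 3 u² u_x = u u_xxx + 2 u_x u_xx`, `u(0, x) = u₀(x)`.
For such `u` every term of the equation is in `L²(ℝ)`, and the equation is an identity in `L²(ℝ)`
at every time in `[0, T)`. -/
def IsSolution (lam : ℝ) (T : EReal) (u₀ : ℝ → ℝ) (u : ℝ → ℝ → ℝ) : Prop :=
  0 < T ∧ u 0 =ᵐ[volume] u₀ ∧ ContinuousInSobolev 3 (timeInterval T) u ∧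
    ∃ ut : ℝ → ℝ → ℝ,
      ContinuousInSobolev 2 (timeInterval T) ut ∧
      HasTimeDerivInSobolev 2 (timeInterval T) u ut ∧
      ∀ t ∈ timeInterval T, ∀ᵐ x ∂(volume : Measure ℝ),
        ut t x - weakDeriv^[2] (ut t) x + lam * (u t x - weakDeriv^[2] (u t) x)
            + 3 * u t x ^ 2 * weakDeriv (u t) x
          = u t x * weakDeriv^[3] (u t) x + 2 * weakDeriv (u t) x * weakDeriv^[2] (u t) x

/-- A function `u` on the time interval `[0, T)` blows up in finite time (in `H³(ℝ)`):
`T` is finite and `limsup_{t → T⁻} ‖u(t)‖_{H³} = ∞`. -/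
def BlowsUpInFiniteTime (T : EReal) (u : ℝ → ℝ → ℝ) : Prop :=
  ∃ τ : ℝ, T = (τ : EReal) ∧
    limsup (fun t => (sobolevNorm 3 (u t) : EReal)) (𝓝[<] τ) = ⊤

/-! Put m = u - u_xx and n = m_x. The equation becomes m_t = -λm - u n - 2u_x m + 3(u u_x - u² u_x),
and expanding the squares gives ‖u‖²_{H³} = ‖m‖² + ‖n‖² = ‖m‖²_{H¹}, with L² norms on the right. It
is therefore enough to estimate m and n in L².

Three energy estimates are chained. Pairing the equation with u cancels all nonlinear terms
(`EquationAt.inner_add_inner`), so ‖u‖_{H¹}, and with it sup |u|, grows at most exponentially.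
Pairing with m turns the transport term into a multiple of ∫ u_x m²; the total is -3∫ u_x m², which
the lower bound on u_x controls (`EquationAt.inner_le`). For n the corresponding term is -5∫ u_x n²,
again controlled by the lower bound, and the remaining terms involve only quantities bounded before
(`EquationAt.production_le`).

The last estimate is not a formal computation: n_t would contain u n_x, and n is merely in L². The
energy balance is therefore written for difference quotients of m, integrated in time, and only then
is the step sent to zero (`SolutionCurve.norm_n_sq_le`). Translations on L² provide the tools: a
weak derivative in L² is the strong limit of difference quotients.

The factor in front of the exponential must be exactly 1. Every forcing term is at most a constant
times an exponential, so when the initial size Y is positive a rate that is large relative to the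
constant divided by Y absorbs it (`exists_rate`). This rate depends on Y but not on the length of
the time interval. If Y = 0, the H¹ estimate forces u = 0. -/

/-! ### Primitives of locally integrable functions -/

theorem MeasureTheory.LocallyIntegrable.intervalIntegrable' {g : ℝ → ℝ}
    (hg : LocallyIntegrable g volume) (a b : ℝ) : IntervalIntegrable g volume a b :=
  intervalIntegrable_iff.mpr <|
    (hg.integrableOn_isCompact isCompact_uIcc).mono_set Set.uIoc_subset_uIcc

/-- `F` is a primitive of the locally integrable function `g`. -/
def IsPrimitive (F g : ℝ → ℝ) : Prop :=
  LocallyIntegrable g volume ∧ ∀ a b, F b - F a = ∫ x in a..b, g x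

namespace IsPrimitive

variable {F G f g : ℝ → ℝ}

theorem eq_add (h : IsPrimitive F g) (a : ℝ) : F = fun x => F a + ∫ y in a..x, g y := by
  funext x
  rw [← h.2 a x]; ring

theorem continuous (h : IsPrimitive F g) : Continuous F := by
  rw [h.eq_add 0]
  exact continuous_const.add (intervalIntegral.continuous_primitive (h.1.intervalIntegrable') 0)

theorem absolutelyContinuousOnInterval (h : IsPrimitive F g) (a b : ℝ) :
    AbsolutelyContinuousOnInterval F a b := by
  have h1 : AbsolutelyContinuousOnInterval (fun _ : ℝ => F a) a b :=
    (contDiff_const (n := 1)).contDiffOn.absolutelyContinuousOnInterval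
  have h2 := (h.1.intervalIntegrable' a b).absolutelyContinuousOnInterval_intervalIntegral
    (c := a) (by simp)
  rw [h.eq_add a]
  exact h1.add h2

theorem ae_deriv_eq (h : IsPrimitive F g) : ∀ᵐ x, deriv F x = g x := by
  filter_upwards [LocallyIntegrable.ae_hasDerivAt_integral h.1] with x hx
  rw [h.eq_add 0]
  exact ((hx 0).const_add _).deriv

theorem hasWeakDeriv (h : IsPrimitive F g) : HasWeakDeriv F g := by
  refine ⟨h.continuous.locallyIntegrable, h.1, fun φ hφ hc => ?_⟩
  obtain ⟨R, hR0, hR⟩ : ∃ R > 0, tsupport φ ⊆ Metric.ball 0 R := by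
    obtain ⟨R, hR⟩ := hc.isCompact.isBounded.subset_ball 0
    exact ⟨max R 1, by positivity, hR.trans (Metric.ball_subset_ball (le_max_left _ _))⟩
  have hIoc : Metric.ball (0 : ℝ) R ⊆ Set.Ioc (-R) R := by
    intro x hx
    rw [mem_ball_zero_iff, Real.norm_eq_abs, abs_lt] at hx
    exact ⟨hx.1, hx.2.le⟩
  have h1 : ∫ x in (-R)..R, F x * deriv φ x = ∫ x, F x * deriv φ x := by
    refine intervalIntegral.integral_eq_integral_of_support_subset ?_
    refine (Function.support_mul_subset_right _ _).trans ?_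
    exact (support_deriv_subset).trans (hR.trans hIoc)
  have h2 : ∫ x in (-R)..R, g x * φ x = ∫ x, g x * φ x := by
    refine intervalIntegral.integral_eq_integral_of_support_subset ?_
    refine (Function.support_mul_subset_right _ _).trans ?_
    exact (subset_tsupport _).trans (hR.trans hIoc)
  have hz : ∀ x, x ∉ Metric.ball (0 : ℝ) R → φ x = 0 := fun x hx =>
    image_eq_zero_of_notMem_tsupport fun h' => hx (hR h')
  rw [← h1, ← h2, (h.absolutelyContinuousOnInterval (-R) R).integral_mul_deriv_eq_deriv_mul
    (hφ.of_le (by exact_mod_cast le_top)).contDiffOn.absolutelyContinuousOnInterval,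
    hz R (by simp [abs_of_pos hR0]), hz (-R) (by simp [abs_of_pos hR0])]
  simp only [mul_zero, sub_self, zero_sub]
  congr 1
  refine intervalIntegral.integral_congr_ae ?_
  filter_upwards [h.ae_deriv_eq] with x hx _
  rw [hx]

/-- Absolute continuity gives the Leibniz rule in integrated form; through absolutely continuous
representatives it yields the weak product rule without mollification. -/
theorem mul (hF : IsPrimitive F f) (hG : IsPrimitive G g) :
    IsPrimitive (fun x => F x * G x) (fun x => f x * G x + F x * g x) := by
  constructor
  · refine LocallyIntegrable.add ?_ ?_
    · rw [← locallyIntegrableOn_univ] at *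
      exact (locallyIntegrableOn_univ.2 hF.1).mul_continuousOn hG.continuous.continuousOn
        isOpen_univ.isLocallyClosed
    · rw [← locallyIntegrableOn_univ] at *
      exact (locallyIntegrableOn_univ.2 hG.1).continuousOn_mul hF.continuous.continuousOn
        isOpen_univ.isLocallyClosed
  · intro a b
    rw [← (hF.absolutelyContinuousOnInterval a b).integral_deriv_mul_eq_sub
      (hG.absolutelyContinuousOnInterval a b)]
    refine intervalIntegral.integral_congr_ae ?_
    filter_upwards [hF.ae_deriv_eq, hG.ae_deriv_eq] with x h1 h2 _
    rw [h1, h2]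

end IsPrimitive

theorem LocallyIntegrable.isPrimitive_integral {g : ℝ → ℝ} (hg : LocallyIntegrable g volume) :
    IsPrimitive (fun x => ∫ y in (0 : ℝ)..x, g y) g := by
  refine ⟨hg, fun a b => ?_⟩
  exact intervalIntegral.integral_interval_sub_left (hg.intervalIntegrable' _ _)
    (hg.intervalIntegrable' _ _)

/-! ### Calculus of weak derivatives -/

theorem MeasureTheory.LocallyIntegrable.integrable_mul_test {f φ : ℝ → ℝ}
    (hf : LocallyIntegrable f volume) (hφ : Continuous φ) (hc : HasCompactSupport φ) :
    Integrable (fun x => f x * φ x) volume := by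
  simpa [mul_comm] using hf.integrable_smul_left_of_hasCompactSupport hφ hc

/-- A smooth compactly supported function of zero mean has a smooth compactly supported
primitive. -/
theorem exists_contDiff_primitive_of_integral_eq_zero {φ : ℝ → ℝ} (hφ : ContDiff ℝ ∞ φ)
    (hc : HasCompactSupport φ) (h0 : ∫ x, φ x = 0) :
    ∃ Φ : ℝ → ℝ, ContDiff ℝ ∞ Φ ∧ HasCompactSupport Φ ∧ deriv Φ = φ := by
  obtain ⟨R, hR0, hR⟩ : ∃ R > 0, tsupport φ ⊆ Metric.ball 0 R := by
    obtain ⟨R, hR⟩ := hc.isCompact.isBounded.subset_ball 0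
    exact ⟨max R 1, by positivity, hR.trans (Metric.ball_subset_ball (le_max_left _ _))⟩
  have hz : ∀ x, x ∉ Metric.ball (0 : ℝ) R → φ x = 0 := fun x hx =>
    image_eq_zero_of_notMem_tsupport fun h' => hx (hR h')
  have hd : ∀ x, HasDerivAt (fun x => ∫ y in (-R)..x, φ y) (φ x) x := fun x =>
    intervalIntegral.integral_hasDerivAt_right (hφ.continuous.intervalIntegrable _ _)
      (hφ.continuous.stronglyMeasurableAtFilter _ _) hφ.continuous.continuousAt
  have hd' : deriv (fun x => ∫ y in (-R)..x, φ y) = φ := funext fun x => (hd x).deriv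
  refine ⟨fun x => ∫ y in (-R)..x, φ y, ?_, ?_, hd'⟩
  · exact contDiff_infty_iff_deriv.2 ⟨fun x => (hd x).differentiableAt, by rwa [hd']⟩
  · refine HasCompactSupport.of_support_subset_isCompact (isCompact_Icc (a := -R) (b := R)) ?_
    intro x hx
    by_contra hx'
    apply hx
    rw [Set.mem_Icc, not_and_or, not_le, not_le] at hx'
    rcases hx' with hx' | hx'
    · change ∫ y in (-R)..x, φ y = 0
      rw [intervalIntegral.integral_congr (g := fun _ => 0)]
      · simp
      · intro y hy
        rw [Set.uIcc_of_ge hx'.le] at hy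
        refine hz y fun h => ?_
        rw [mem_ball_zero_iff, Real.norm_eq_abs, abs_lt] at h
        linarith [hy.2]
    · change ∫ y in (-R)..x, φ y = 0
      rw [intervalIntegral.integral_eq_integral_of_support_subset, h0]
      intro y hy
      by_contra hy'
      apply hy
      refine hz y fun h => hy' ?_
      rw [mem_ball_zero_iff, Real.norm_eq_abs, abs_lt] at h
      exact ⟨h.1, by linarith⟩

namespace HasWeakDeriv

variable {f f' g g' : ℝ → ℝ}

theorem congr (h : HasWeakDeriv f g) (hf : f =ᵐ[volume] f') (hg : g =ᵐ[volume] g') :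
    HasWeakDeriv f' g' := by
  refine ⟨h.1.congr hf, h.2.1.congr hg, fun φ hφ hc => ?_⟩
  have h1 : ∫ x, f x * deriv φ x = ∫ x, f' x * deriv φ x :=
    integral_congr_ae (hf.mul (ae_eq_refl (deriv φ)))
  have h2 : ∫ x, g x * φ x = ∫ x, g' x * φ x := integral_congr_ae (hg.mul (ae_eq_refl φ))
  rw [← h1, ← h2]
  exact h.2.2 φ hφ hc

theorem unique (h : HasWeakDeriv f g) (h' : HasWeakDeriv f g') : g =ᵐ[volume] g' := by
  refine ae_eq_of_integral_contDiff_smul_eq h.2.1 h'.2.1 fun φ hφ hc => ?_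
  have := (h.2.2 φ hφ hc).symm.trans (h'.2.2 φ hφ hc)
  simpa [mul_comm] using this

theorem add (h : HasWeakDeriv f g) (h' : HasWeakDeriv f' g') :
    HasWeakDeriv (fun x => f x + f' x) (fun x => g x + g' x) := by
  refine ⟨h.1.add h'.1, h.2.1.add h'.2.1, fun φ hφ hc => ?_⟩
  have hd : Continuous (deriv φ) := hφ.continuous_deriv (by exact_mod_cast le_top)
  simp only [add_mul]
  rw [integral_add (h.1.integrable_mul_test hd hc.deriv) (h'.1.integrable_mul_test hd hc.deriv),
    integral_add (h.2.1.integrable_mul_test hφ.continuous hc)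
      (h'.2.1.integrable_mul_test hφ.continuous hc), h.2.2 φ hφ hc, h'.2.2 φ hφ hc]
  ring

theorem const_mul (c : ℝ) (h : HasWeakDeriv f g) :
    HasWeakDeriv (fun x => c * f x) (fun x => c * g x) := by
  refine ⟨h.1.smul c, h.2.1.smul c, fun φ hφ hc => ?_⟩
  simp only [mul_assoc, integral_const_mul, h.2.2 φ hφ hc]
  ring

theorem sub (h : HasWeakDeriv f g) (h' : HasWeakDeriv f' g') :
    HasWeakDeriv (fun x => f x - f' x) (fun x => g x - g' x) := by
  simpa [sub_eq_add_neg] using h.add (h'.const_mul (-1))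

/-- A function whose weak derivative vanishes is constant. -/
theorem ae_eq_const (h : HasWeakDeriv f fun _ => 0) : ∃ c, f =ᵐ[volume] fun _ => c := by
  let ψ : ContDiffBump (0 : ℝ) := default
  have hψ : ContDiff ℝ ∞ (ψ.normed volume) := ψ.contDiff_normed
  have hψc : HasCompactSupport (ψ.normed volume) := ψ.hasCompactSupport_normed
  refine ⟨∫ x, f x * ψ.normed volume x, ?_⟩
  refine ae_eq_of_integral_contDiff_smul_eq h.1 (locallyIntegrable_const _) fun φ hφ hc => ?_
  have hφi : Integrable φ volume := hφ.continuous.integrable_of_hasCompactSupport hc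
  have hψi : Integrable (ψ.normed volume) volume :=
    hψ.continuous.integrable_of_hasCompactSupport hψc
  -- Subtracting from φ its mean times a normalized bump leaves a function of zero mean, hence the
  -- derivative of a test function, against which f integrates to zero.
  obtain ⟨Φ, hΦ, hΦc, hd⟩ := exists_contDiff_primitive_of_integral_eq_zero
    (φ := fun x => φ x - (∫ y, φ y) * ψ.normed volume x) (hφ.sub (contDiff_const.mul hψ))
    (hc.sub (hψc.mul_left (f := fun _ => ∫ y, φ y))) (by
      rw [integral_sub hφi (hψi.const_mul _), integral_const_mul, ψ.integral_normed]; ring)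
  have h1 := h.2.2 Φ hΦ hΦc
  simp only [hd, zero_mul, integral_zero, neg_zero, mul_sub] at h1
  rw [integral_sub (h.1.integrable_mul_test hφ.continuous hc)] at h1
  · simp only [smul_eq_mul, integral_mul_const]
    have h2 : ∫ x, f x * ((∫ y, φ y) * ψ.normed volume x)
        = (∫ y, φ y) * ∫ x, f x * ψ.normed volume x := by
      rw [← integral_const_mul]; congr 1; funext x; ring
    rw [h2] at h1
    simp only [mul_comm (φ _)]
    linarith
  · have := (h.1.integrable_mul_test hψ.continuous hψc).const_mul (∫ y, φ y)
    refine this.congr (ae_of_all _ fun x => ?_)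
    ring

/-- A weakly differentiable function has an absolutely continuous representative. -/
theorem exists_isPrimitive (h : HasWeakDeriv f g) : ∃ F, f =ᵐ[volume] F ∧ IsPrimitive F g := by
  have h1 := LocallyIntegrable.isPrimitive_integral h.2.1
  have h2 := h.sub h1.hasWeakDeriv
  simp only [sub_self] at h2
  obtain ⟨c, hc⟩ := h2.ae_eq_const
  refine ⟨fun x => c + ∫ y in (0 : ℝ)..x, g y, ?_, h.2.1, fun a b => ?_⟩
  · filter_upwards [hc] with x hx
    linarith
  · rw [← h1.2 a b]; ring

theorem mul (h : HasWeakDeriv f g) (h' : HasWeakDeriv f' g') :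
    HasWeakDeriv (fun x => f x * f' x) (fun x => g x * f' x + f x * g' x) := by
  obtain ⟨F, hF, hFp⟩ := h.exists_isPrimitive
  obtain ⟨F', hF', hFp'⟩ := h'.exists_isPrimitive
  refine (hFp.mul hFp').hasWeakDeriv.congr ?_ ?_
  · filter_upwards [hF, hF'] with x h1 h2
    rw [h1, h2]
  · filter_upwards [hF, hF'] with x h1 h2
    rw [h1, h2]

theorem weakDeriv (h : HasWeakDeriv f g) : HasWeakDeriv f (weakDeriv f) := by
  have h' : ∃ g, HasWeakDeriv f g := ⟨g, h⟩
  rw [_root_.weakDeriv, dif_pos h']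
  exact h'.choose_spec

theorem weakDeriv_ae_eq (h : HasWeakDeriv f g) : _root_.weakDeriv f =ᵐ[volume] g :=
  h.weakDeriv.unique h

end HasWeakDeriv

theorem weakDeriv_congr {f f' : ℝ → ℝ} (h : f =ᵐ[volume] f') : weakDeriv f = weakDeriv f' := by
  have : HasWeakDeriv f = HasWeakDeriv f' := by
    funext g
    exact propext ⟨fun hg => hg.congr h (ae_eq_refl _), fun hg => hg.congr h.symm (ae_eq_refl _)⟩
  unfold weakDeriv
  rw [this]

/-! ### Classes and inner products in L² -/

open Classical in
/-- The class of `f` in `L²(ℝ)` (zero if `f` is not square integrable). -/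
noncomputable def toL2 (f : ℝ → ℝ) : Lp ℝ 2 (volume : Measure ℝ) :=
  if h : MemLp f 2 volume then h.toLp f else 0

section toL2

variable {f g : ℝ → ℝ}

theorem toL2_eq (h : MemLp f 2 volume) : toL2 f = h.toLp f := dif_pos h

theorem toL2_congr (h : f =ᵐ[volume] g) : toL2 f = toL2 g := by
  by_cases hf : MemLp f 2 volume
  · have hg := (memLp_congr_ae h).1 hf
    rw [toL2_eq hf, toL2_eq hg]
    exact MemLp.toLp_congr hf hg h
  · have hg : ¬ MemLp g 2 volume := fun hg => hf ((memLp_congr_ae h).2 hg)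
    rw [toL2, toL2, dif_neg hf, dif_neg hg]

theorem coeFn_toL2 (h : MemLp f 2 volume) : toL2 f =ᵐ[volume] f := by
  rw [toL2_eq h]; exact h.coeFn_toLp

theorem toL2_add (hf : MemLp f 2 volume) (hg : MemLp g 2 volume) :
    toL2 (fun x => f x + g x) = toL2 f + toL2 g := by
  rw [toL2_eq hf, toL2_eq hg, toL2_eq (f := fun x => f x + g x) (hf.add hg)]
  exact MemLp.toLp_add hf hg

theorem toL2_sub (hf : MemLp f 2 volume) (hg : MemLp g 2 volume) :
    toL2 (fun x => f x - g x) = toL2 f - toL2 g := by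
  rw [toL2_eq hf, toL2_eq hg, toL2_eq (f := fun x => f x - g x) (hf.sub hg)]
  exact MemLp.toLp_sub hf hg

theorem toL2_const_mul (c : ℝ) (hf : MemLp f 2 volume) :
    toL2 (fun x => c * f x) = c • toL2 f := by
  rw [toL2_eq hf, toL2_eq (f := fun x => c * f x) (hf.const_mul c)]
  exact MemLp.toLp_const_smul c hf

theorem inner_toL2 (hf : MemLp f 2 volume) (hg : MemLp g 2 volume) :
    inner ℝ (toL2 f) (toL2 g) = ∫ x, f x * g x := by
  rw [L2.inner_def]
  refine integral_congr_ae ?_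
  filter_upwards [coeFn_toL2 hf, coeFn_toL2 hg] with x h1 h2
  rw [h1, h2, real_inner_eq_re_inner, RCLike.inner_apply]
  simp [mul_comm]

theorem norm_toL2_sq (hf : MemLp f 2 volume) : ‖toL2 f‖ ^ 2 = ∫ x, f x ^ 2 := by
  rw [← real_inner_self_eq_norm_sq, inner_toL2 hf hf]
  simp only [sq]

theorem norm_toL2_le_mul {C : ℝ} (hf : MemLp f 2 volume) (hg : MemLp g 2 volume)
    (h : ∀ᵐ x, |f x| ≤ C * |g x|) : ‖toL2 f‖ ≤ C * ‖toL2 g‖ := by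
  refine Lp.norm_le_mul_norm_of_ae_le_mul ?_
  filter_upwards [coeFn_toL2 hf, coeFn_toL2 hg, h] with x h1 h2 h3
  rw [h1, h2]; exact h3

theorem integral_mul_le_norm (hf : MemLp f 2 volume) (hg : MemLp g 2 volume) :
    |∫ x, f x * g x| ≤ ‖toL2 f‖ * ‖toL2 g‖ := by
  rw [← inner_toL2 hf hg]
  exact abs_real_inner_le_norm _ _

theorem MeasureTheory.MemLp.bdd_mul_of_ae {C : ℝ} (hg : MemLp g 2 volume)
    (hf : AEStronglyMeasurable f volume) (h : ∀ᵐ x, |f x| ≤ C) :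
    MemLp (fun x => f x * g x) 2 volume := by
  refine hg.of_le_mul (c := C) (hf.mul hg.1) ?_
  filter_upwards [h] with x hx
  rw [norm_mul]
  exact mul_le_mul_of_nonneg_right hx (norm_nonneg _)

/-- Cauchy–Schwarz against the indicator of a unit interval, whose L² norm is 1. -/
theorem setIntegral_abs_le_norm_toL2 (hf : MemLp f 2 volume) (a : ℝ) :
    ∫ x in a..(a + 1), |f x| ≤ ‖toL2 f‖ := by
  have hi : MemLp ((Set.Ioc a (a + 1)).indicator fun _ => (1 : ℝ)) 2 volume :=
    memLp_indicator_const 2 measurableSet_Ioc 1 (Or.inr (by simp))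
  have h1 : ∫ x in a..(a + 1), |f x|
      = ∫ x, |f x| * (Set.Ioc a (a + 1)).indicator (fun _ => (1 : ℝ)) x := by
    rw [intervalIntegral.integral_of_le (by linarith), ← integral_indicator measurableSet_Ioc]
    congr 1; funext x
    by_cases hx : x ∈ Set.Ioc a (a + 1) <;> simp [hx]
  have h2 := (le_abs_self _).trans (integral_mul_le_norm (f := fun x => |f x|) hf.norm hi)
  have h3 : ‖toL2 fun x => |f x|‖ ≤ 1 * ‖toL2 f‖ :=
    norm_toL2_le_mul hf.norm hf (ae_of_all _ fun x => by simp)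
  have h4 : ‖toL2 ((Set.Ioc a (a + 1)).indicator fun _ => (1 : ℝ))‖ ^ 2 = 1 := by
    rw [norm_toL2_sq hi]
    have : (fun x => (Set.Ioc a (a + 1)).indicator (fun _ => (1 : ℝ)) x ^ 2)
        = (Set.Ioc a (a + 1)).indicator fun _ => (1 : ℝ) := by
      funext x
      by_cases hx : x ∈ Set.Ioc a (a + 1) <;> simp [hx]
    rw [this, integral_indicator measurableSet_Ioc]
    simp
  rw [pow_eq_one_iff_of_nonneg (norm_nonneg _) two_ne_zero] at h4
  rw [h1]
  rw [h4, mul_one] at h2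
  linarith

end toL2

/-! ### Translations and difference quotients -/

/-- Translation on `L²(ℝ)`. -/
noncomputable def shiftL2 (h : ℝ) :
    Lp ℝ 2 (volume : Measure ℝ) →ₗᵢ[ℝ] Lp ℝ 2 (volume : Measure ℝ) :=
  Lp.compMeasurePreservingₗᵢ ℝ (fun x => x + h) (measurePreserving_add_right volume h)

theorem MeasureTheory.MemLp.shift {f : ℝ → ℝ} (hf : MemLp f 2 volume) (h : ℝ) :
    MemLp (fun x => f (x + h)) 2 volume :=
  hf.comp_measurePreserving (measurePreserving_add_right volume h)

theorem toL2_shift {f : ℝ → ℝ} (hf : MemLp f 2 volume) (h : ℝ) :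
    toL2 (fun x => f (x + h)) = shiftL2 h (toL2 f) := by
  rw [toL2_eq hf, toL2_eq (hf.shift h)]
  rfl

theorem continuous_shiftL2 (F : Lp ℝ 2 (volume : Measure ℝ)) :
    Continuous fun h => shiftL2 h F := by
  let G : C(ℝ × ℝ, ℝ) := ⟨fun p => p.2 + p.1, by fun_prop⟩
  exact continuous_const.compMeasurePreservingLp (G.curry.continuous)
    (fun h => measurePreserving_add_right volume h) (by simp)

theorem shiftL2_zero (F : Lp ℝ 2 (volume : Measure ℝ)) : shiftL2 0 F = F := by
  have h : F = toL2 F := by rw [toL2_eq (Lp.memLp F), Lp.toLp_coeFn]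
  rw [h, ← toL2_shift (Lp.memLp F)]
  simp

/-- `f` belongs to `H¹(ℝ)` and `g` is its weak derivative. -/
structure HasL2Deriv (f g : ℝ → ℝ) : Prop where
  memLp : MemLp f 2 volume
  memLp_deriv : MemLp g 2 volume
  hasWeakDeriv : HasWeakDeriv f g

/-- The difference quotient of `f` with step `h`. -/
noncomputable def diffQuot (h : ℝ) (f : ℝ → ℝ) : ℝ → ℝ := fun x => h⁻¹ * (f (x + h) - f x)

theorem MeasureTheory.MemLp.diffQuot {f : ℝ → ℝ} (hf : MemLp f 2 volume) (h : ℝ) :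
    MemLp (diffQuot h f) 2 volume :=
  ((hf.shift h).sub hf).const_mul _

theorem toL2_diffQuot {f : ℝ → ℝ} (hf : MemLp f 2 volume) (h : ℝ) :
    toL2 (diffQuot h f) = h⁻¹ • (shiftL2 h (toL2 f) - toL2 f) := by
  rw [← toL2_shift hf, ← toL2_sub (hf.shift h) hf, ← toL2_const_mul (f := fun x => f (x + h) - f x) _ ((hf.shift h).sub hf)]
  rfl

namespace HasL2Deriv

variable {f g f' g' : ℝ → ℝ}

theorem add (h : HasL2Deriv f g) (h' : HasL2Deriv f' g') :
    HasL2Deriv (fun x => f x + f' x) (fun x => g x + g' x) :=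
  ⟨h.1.add h'.1, h.2.add h'.2, h.3.add h'.3⟩

theorem sub (h : HasL2Deriv f g) (h' : HasL2Deriv f' g') :
    HasL2Deriv (fun x => f x - f' x) (fun x => g x - g' x) :=
  ⟨h.1.sub h'.1, h.2.sub h'.2, h.3.sub h'.3⟩

theorem const_mul (c : ℝ) (h : HasL2Deriv f g) :
    HasL2Deriv (fun x => c * f x) (fun x => c * g x) :=
  ⟨h.1.const_mul c, h.2.const_mul c, h.3.const_mul c⟩

/-- The Sobolev inequality in one dimension. -/
theorem ae_abs_le (h : HasL2Deriv f g) : ∀ᵐ x, |f x| ≤ ‖toL2 f‖ + ‖toL2 g‖ := by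
  obtain ⟨F, hF, hFp⟩ := h.hasWeakDeriv.exists_isPrimitive
  have hFm : MemLp F 2 volume := (memLp_congr_ae hF).1 h.memLp
  filter_upwards [hF] with x hx
  rw [hx, toL2_congr hF]
  have hgi : ∀ a b, IntervalIntegrable (fun z => |g z|) volume a b := fun a b =>
    (h.hasWeakDeriv.2.1.intervalIntegrable' a b).abs
  -- The pointwise value is compared with every value on a unit interval and then averaged over y.
  have h1 : ∀ y ∈ Set.Icc x (x + 1), |F x| ≤ |F y| + ∫ z in x..(x + 1), |g z| := by
    intro y hy
    have h2 : |F y - F x| ≤ ∫ z in x..(x + 1), |g z| := by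
      rw [hFp.2 x y]
      refine (intervalIntegral.abs_integral_le_integral_abs hy.1).trans ?_
      refine intervalIntegral.integral_mono_interval le_rfl hy.1 hy.2
        (ae_of_all _ fun z => abs_nonneg _) (hgi _ _)
    have h3 := abs_sub_abs_le_abs_sub (F x) (F y)
    rw [abs_sub_comm] at h3
    linarith
  have h4 : ∫ _ in x..(x + 1), |F x|
      ≤ ∫ y in x..(x + 1), (|F y| + ∫ z in x..(x + 1), |g z|) := by
    refine intervalIntegral.integral_mono_on (by linarith) (by simp) ?_ h1
    exact (hFp.continuous.abs.add continuous_const).intervalIntegrable _ _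
  rw [intervalIntegral.integral_add (hFp.continuous.abs.intervalIntegrable _ _) (by simp)] at h4
  simp only [intervalIntegral.integral_const, add_sub_cancel_left, one_smul] at h4
  linarith [setIntegral_abs_le_norm_toL2 hFm x, setIntegral_abs_le_norm_toL2 h.memLp_deriv x]

theorem mul (h : HasL2Deriv f g) (h' : HasL2Deriv f' g') :
    HasL2Deriv (fun x => f x * f' x) (fun x => g x * f' x + f x * g' x) := by
  refine ⟨h'.memLp.bdd_mul_of_ae h.memLp.1 h.ae_abs_le, ?_, h.3.mul h'.3⟩
  refine MemLp.add ?_ (h'.memLp_deriv.bdd_mul_of_ae h.memLp.1 h.ae_abs_le)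
  refine (h.memLp_deriv.bdd_mul_of_ae h'.memLp.1 h'.ae_abs_le).congr_norm
    (h.memLp_deriv.1.mul h'.memLp.1) (ae_of_all _ fun x => ?_)
  rw [mul_comm]

theorem shift (h : HasL2Deriv f g) (s : ℝ) :
    HasL2Deriv (fun x => f (x + s)) (fun x => g (x + s)) := by
  refine ⟨h.1.shift s, h.2.shift s, (h.1.shift s).locallyIntegrable one_le_two,
    (h.2.shift s).locallyIntegrable one_le_two, fun φ hφ hc => ?_⟩
  have hc' : HasCompactSupport fun x => φ (x - s) :=
    hc.comp_homeomorph (Homeomorph.subRight s)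
  have h1 := h.3.2.2 (fun x => φ (x - s)) (hφ.comp (contDiff_id.sub contDiff_const)) hc'
  simp only [deriv_comp_sub_const] at h1
  rw [← integral_add_right_eq_self _ s, ← integral_add_right_eq_self (fun x => g x * _) s] at h1
  simpa using h1

theorem diffQuot (h : HasL2Deriv f g) (s : ℝ) : HasL2Deriv (diffQuot s f) (diffQuot s g) :=
  ((h.shift s).sub h).const_mul _

/-- The pairing is the convolution of f with the reflected test function, so the derivative falls on
φ; the weak derivative moves it back to f. -/
theorem hasDerivAt_integral_shift (h : HasL2Deriv f g) {φ : ℝ → ℝ} (hφ : ContDiff ℝ ∞ φ)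
    (hc : HasCompactSupport φ) (s : ℝ) :
    HasDerivAt (fun s => ∫ x, φ x * f (x + s)) (∫ x, φ x * g (x + s)) s := by
  have hc' : HasCompactSupport fun x => φ (-x) := hc.comp_homeomorph (Homeomorph.neg ℝ)
  have hφ' : ContDiff ℝ 1 fun x => φ (-x) :=
    (hφ.of_le (by exact_mod_cast le_top)).comp contDiff_neg
  have h1 := hc'.hasDerivAt_convolution_right (ContinuousLinearMap.mul ℝ ℝ) h.3.1 hφ' s
  have h2 := (h.shift s).3.2.2 φ hφ hc
  have h3 : (convolution f (fun x => φ (-x)) (ContinuousLinearMap.mul ℝ ℝ) volume)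
      = fun s => ∫ x, φ x * f (x + s) := by
    funext s
    rw [convolution, ← integral_add_right_eq_self _ s]
    congr 1; funext x
    simp [mul_comm]
  have h4 : convolution f (deriv fun x => φ (-x)) (ContinuousLinearMap.mul ℝ ℝ) volume s
      = ∫ x, φ x * g (x + s) := by
    rw [convolution, ← integral_add_right_eq_self _ s]
    simp only [deriv_comp_neg, ContinuousLinearMap.mul_apply', mul_neg, integral_neg,
      sub_add_cancel_right, neg_neg, h2]
    simp only [mul_comm]
  rwa [h3, h4] at h1

/-- The weak derivative is the generator of translations: tested against a smooth φ, both sides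
agree by the fundamental theorem of calculus for a scalar function of the shift, and test functions
separate elements of L². -/
theorem shiftL2_sub_eq_integral (h : HasL2Deriv f g) (t : ℝ) :
    shiftL2 t (toL2 f) - toL2 f = ∫ s in (0 : ℝ)..t, shiftL2 s (toL2 g) := by
  rw [← sub_eq_zero]
  set v := shiftL2 t (toL2 f) - toL2 f - ∫ s in (0 : ℝ)..t, shiftL2 s (toL2 g) with hv
  rw [Lp.eq_zero_iff_ae_eq_zero]
  refine ae_eq_zero_of_integral_contDiff_smul_eq_zero ((Lp.memLp v).locallyIntegrable one_le_two)
    fun φ hφ hc => ?_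
  have hφm : MemLp φ 2 volume := hφ.continuous.memLp_of_hasCompactSupport hc
  have hv' : v = toL2 v := by rw [toL2_eq (Lp.memLp v), Lp.toLp_coeFn]
  have h1 : ∫ x, φ x • v x = inner ℝ (toL2 φ) v := by
    conv_rhs => rw [hv', inner_toL2 hφm (Lp.memLp v)]
    rfl
  have h2 : ∀ s, HasDerivAt (fun s => inner ℝ (toL2 φ) (shiftL2 s (toL2 f)))
      (inner ℝ (toL2 φ) (shiftL2 s (toL2 g))) s := by
    intro s
    have := h.hasDerivAt_integral_shift hφ hc s
    simp only [← toL2_shift h.1, ← toL2_shift h.2, inner_toL2 hφm (h.1.shift _),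
      inner_toL2 hφm (h.2.shift _)]
    exact this
  have hcont : Continuous fun s => inner ℝ (toL2 φ) (shiftL2 s (toL2 g)) :=
    continuous_const.inner (continuous_shiftL2 _)
  have h3 := intervalIntegral.integral_eq_sub_of_hasDerivAt (a := 0) (b := t)
    (fun s _ => h2 s) (hcont.intervalIntegrable _ _)
  have h4 := (innerSL ℝ (toL2 φ)).intervalIntegral_comp_comm
    ((continuous_shiftL2 (toL2 g)).intervalIntegrable (μ := volume) 0 t)
  simp only [innerSL_apply_apply] at h4
  rw [h1, hv, inner_sub_right, inner_sub_right, ← h4, h3, shiftL2_zero]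
  ring

theorem hasDerivAt_shiftL2 (h : HasL2Deriv f g) :
    HasDerivAt (fun s => shiftL2 s (toL2 f)) (toL2 g) 0 := by
  have h1 : (fun s => shiftL2 s (toL2 f))
      = fun t => toL2 f + ∫ s in (0 : ℝ)..t, shiftL2 s (toL2 g) := by
    funext t
    rw [← h.shiftL2_sub_eq_integral t]; abel
  have hc := continuous_shiftL2 (toL2 g)
  have h2 := intervalIntegral.integral_hasDerivAt_right (hc.intervalIntegrable 0 0)
    (hc.stronglyMeasurableAtFilter volume _) hc.continuousAt
  rw [shiftL2_zero] at h2
  rw [h1]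
  exact h2.const_add _

theorem tendsto_diffQuot (h : HasL2Deriv f g) :
    Tendsto (fun s => toL2 (_root_.diffQuot s f)) (𝓝[≠] 0) (𝓝 (toL2 g)) := by
  have := hasDerivAt_iff_tendsto_slope_zero.1 h.hasDerivAt_shiftL2
  simp only [zero_add, shiftL2_zero] at this
  simpa only [toL2_diffQuot h.1] using this

theorem norm_diffQuot_le (h : HasL2Deriv f g) (s : ℝ) :
    ‖toL2 (_root_.diffQuot s f)‖ ≤ ‖toL2 g‖ := by
  rw [toL2_diffQuot h.1, h.shiftL2_sub_eq_integral, norm_smul]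
  have h1 : ‖∫ r in (0 : ℝ)..s, shiftL2 r (toL2 g)‖ ≤ ‖toL2 g‖ * |s - 0| :=
    intervalIntegral.norm_integral_le_of_norm_le_const fun r _ => by rw [LinearIsometry.norm_map]
  rw [sub_zero] at h1
  rw [norm_inv, Real.norm_eq_abs]
  rcases eq_or_ne s 0 with rfl | hs
  · simp
  · rw [inv_mul_le_iff₀ (abs_pos.2 hs), mul_comm]
    exact h1

/-- Integration by parts. -/
theorem integral_mul_deriv (h : HasL2Deriv f g) (h' : HasL2Deriv f' g') :
    ∫ x, f x * g' x = -∫ x, g x * f' x := by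
  -- Translating both factors leaves their inner product constant. Its derivative at shift 0
  -- vanishes, which is integration by parts without any discussion of decay at infinity.
  have h1 := h.hasDerivAt_shiftL2.inner ℝ h'.hasDerivAt_shiftL2
  simp only [LinearIsometry.inner_map_map, shiftL2_zero] at h1
  have h2 := h1.unique (hasDerivAt_const _ _)
  rw [inner_toL2 h.1 h'.2, inner_toL2 h.2 h'.1] at h2
  linarith

end HasL2Deriv

/-! ### Products and quadratic forms in L² -/

section multiplication

variable {f g w : ℝ → ℝ} {C k : ℝ}

theorem MeasureTheory.MemLp.mul_of_hasL2Deriv (hw : MemLp w 2 volume) (h : HasL2Deriv f g) :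
    MemLp (fun x => f x * w x) 2 volume :=
  hw.bdd_mul_of_ae h.memLp.1 h.ae_abs_le

theorem norm_toL2_mul_le (hw : MemLp w 2 volume) (hf : AEStronglyMeasurable f volume)
    (h : ∀ᵐ x, |f x| ≤ C) : ‖toL2 fun x => f x * w x‖ ≤ C * ‖toL2 w‖ := by
  refine norm_toL2_le_mul (hw.bdd_mul_of_ae hf h) hw ?_
  filter_upwards [h] with x hx
  rw [abs_mul]
  exact mul_le_mul_of_nonneg_right hx (abs_nonneg _)

theorem HasL2Deriv.norm_mul_le (h : HasL2Deriv f g) (hw : MemLp w 2 volume) :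
    ‖toL2 fun x => f x * w x‖ ≤ (‖toL2 f‖ + ‖toL2 g‖) * ‖toL2 w‖ :=
  norm_toL2_mul_le hw h.memLp.1 h.ae_abs_le

theorem neg_mul_norm_sq_le_inner (hw : MemLp w 2 volume) (h : HasL2Deriv f g)
    (hk : ∀ᵐ x, -k < f x) :
    -k * ‖toL2 w‖ ^ 2 ≤ inner ℝ (toL2 w) (toL2 fun x => f x * w x) := by
  have hfw := hw.mul_of_hasL2Deriv h
  rw [inner_toL2 hw hfw, norm_toL2_sq hw, ← integral_const_mul]
  refine integral_mono_ae (hw.integrable_sq.const_mul _) (hw.integrable_mul hfw) ?_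
  filter_upwards [hk] with x hx
  nlinarith [sq_nonneg (w x)]

/-- `∫ u w w' = - ½ ∫ u' w²`. -/
theorem HasL2Deriv.inner_mul_deriv {u u₁ w w₁ : ℝ → ℝ} (hu : HasL2Deriv u u₁)
    (hw : HasL2Deriv w w₁) :
    inner ℝ (toL2 w) (toL2 fun x => u x * w₁ x)
      = -(1 / 2) * inner ℝ (toL2 w) (toL2 fun x => u₁ x * w x) := by
  have h1 := hw.integral_mul_deriv (hu.mul hw)
  have hm : MemLp (fun x => u x * w₁ x) 2 volume := hw.memLp_deriv.mul_of_hasL2Deriv hu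
  have hm' : MemLp (fun x => u₁ x * w x) 2 volume := by
    simpa only [mul_comm] using hu.memLp_deriv.mul_of_hasL2Deriv hw
  rw [← inner_toL2 hw.1 (hu.mul hw).2, toL2_add hm' hm, inner_add_right] at h1
  have h2 : ∫ x, w₁ x * (u x * w x) = inner ℝ (toL2 w) (toL2 fun x => u x * w₁ x) := by
    rw [inner_toL2 hw.1 hm]
    congr 1; funext x; ring
  rw [h2] at h1
  linarith

/-- `∫ w² w' = 0`. -/
theorem HasL2Deriv.inner_sq_eq_zero {w w₁ : ℝ → ℝ} (hw : HasL2Deriv w w₁) :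
    inner ℝ (toL2 w₁) (toL2 fun x => w x * w x) = 0 := by
  have h1 := hw.integral_mul_deriv (hw.mul hw)
  rw [inner_toL2 hw.2 (hw.mul hw).1]
  have h2 : ∫ x, w x * (w₁ x * w x + w x * w₁ x) = 2 * ∫ x, w₁ x * (w x * w x) := by
    rw [← integral_const_mul]
    congr 1; funext x; ring
  linarith

/-- Since u₁ is itself in H¹, the difference quotients of u converge in H¹, hence uniformly; the
translates of n converge only in L², which suffices for the other factor. -/
theorem HasL2Deriv.tendsto_diffQuot_mul_shift {u u₁ u₂ n : ℝ → ℝ} (hu : HasL2Deriv u u₁)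
    (hu₁ : HasL2Deriv u₁ u₂) (hn : MemLp n 2 volume) :
    Tendsto (fun h => toL2 fun x => _root_.diffQuot h u x * n (x + h)) (𝓝[≠] 0)
      (𝓝 (toL2 fun x => u₁ x * n x)) := by
  rw [tendsto_iff_norm_sub_tendsto_zero]
  have ht1 := tendsto_iff_norm_sub_tendsto_zero.1 hu.tendsto_diffQuot
  have ht2 := tendsto_iff_norm_sub_tendsto_zero.1 hu₁.tendsto_diffQuot
  have ht3 : Tendsto (fun h => ‖shiftL2 h (toL2 n) - toL2 n‖) (𝓝[≠] 0) (𝓝 0) := by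
    rw [← tendsto_iff_norm_sub_tendsto_zero]
    have := (continuous_shiftL2 (toL2 n)).tendsto 0
    rw [shiftL2_zero] at this
    exact this.mono_left nhdsWithin_le_nhds
  have hlim := ((ht1.add ht2).mul_const ‖toL2 n‖).add
    (ht3.const_mul (‖toL2 u₁‖ + ‖toL2 u₂‖))
  simp only [add_zero, zero_mul, mul_zero] at hlim
  refine squeeze_zero (fun _ => norm_nonneg _) (fun h => ?_) hlim
  have hD := (hu.diffQuot h).sub hu₁
  have hDn := (hn.shift h).mul_of_hasL2Deriv (hu.diffQuot h)
  have h1 := hD.norm_mul_le (hn.shift h)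
  have h2 := hu₁.norm_mul_le ((hn.shift h).sub hn)
  rw [toL2_sub (hu.diffQuot h).1 hu₁.1, toL2_sub (hu.diffQuot h).2 hu₁.2, toL2_shift hn,
    LinearIsometry.norm_map] at h1
  have e2 : toL2 ((fun x => n (x + h)) - n) = shiftL2 h (toL2 n) - toL2 n := by
    rw [← toL2_shift hn]; exact toL2_sub (hn.shift h) hn
  rw [e2] at h2
  have e : toL2 (fun x => _root_.diffQuot h u x * n (x + h)) - toL2 (fun x => u₁ x * n x)
      = toL2 (fun x => (_root_.diffQuot h u x - u₁ x) * n (x + h))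
        + toL2 (fun x => u₁ x * ((fun x => n (x + h)) - n) x) := by
    rw [← toL2_sub hDn (hn.mul_of_hasL2Deriv hu₁),
      ← toL2_add ((hn.shift h).mul_of_hasL2Deriv hD)
        (((hn.shift h).sub hn).mul_of_hasL2Deriv hu₁)]
    congr 1; funext x
    simp only [Pi.sub_apply]
    ring
  rw [e]
  exact (norm_add_le _ _).trans (add_le_add h1 h2)

theorem HasL2Deriv.tendsto_mul {ι : Type*} {l : Filter ι} {w : ι → ℝ → ℝ} {w₀ : ℝ → ℝ}
    (h : HasL2Deriv f g) (hw : ∀ i, MemLp (w i) 2 volume) (hw₀ : MemLp w₀ 2 volume)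
    (ht : Tendsto (fun i => toL2 (w i)) l (𝓝 (toL2 w₀))) :
    Tendsto (fun i => toL2 fun x => f x * w i x) l (𝓝 (toL2 fun x => f x * w₀ x)) := by
  rw [tendsto_iff_norm_sub_tendsto_zero] at ht ⊢
  have hlim := ht.const_mul (‖toL2 f‖ + ‖toL2 g‖)
  rw [mul_zero] at hlim
  refine squeeze_zero (fun _ => norm_nonneg _) (fun i => ?_) hlim
  rw [← toL2_sub (hw i) hw₀,
    ← toL2_sub ((hw i).mul_of_hasL2Deriv h) (hw₀.mul_of_hasL2Deriv h)]
  simpa only [mul_sub] using h.norm_mul_le (w := fun x => w i x - w₀ x) ((hw i).sub hw₀)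

end multiplication

/-! ### The equation and its energy identities at a fixed time -/

/-- The data at a fixed time: `u ∈ H³` with weak derivatives `u₁, u₂, u₃`, and `M`, which stands
for `u_t - u_txx`, is given by the equation. -/
structure EquationAt (lam : ℝ) (u u₁ u₂ u₃ M : ℝ → ℝ) : Prop where
  hu : HasL2Deriv u u₁
  hu₁ : HasL2Deriv u₁ u₂
  hu₂ : HasL2Deriv u₂ u₃
  memLp : MemLp M 2 volume
  eq : ∀ᵐ x, M x + lam * (u x - u₂ x) + 3 * u x ^ 2 * u₁ x = u x * u₃ x + 2 * u₁ x * u₂ x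

namespace EquationAt

variable {lam k A : ℝ} {u u₁ u₂ u₃ M : ℝ → ℝ}

theorem hm (h : EquationAt lam u u₁ u₂ u₃ M) :
    HasL2Deriv (fun x => u x - u₂ x) (fun x => u₁ x - u₃ x) := h.hu.sub h.hu₂

theorem hf (h : EquationAt lam u u₁ u₂ u₃ M) :
    HasL2Deriv (fun x => u x * u₁ x - u x * (u x * u₁ x))
      (fun x => u₁ x * u₁ x + u x * u₂ x
        - (u₁ x * (u x * u₁ x) + u x * (u₁ x * u₁ x + u x * u₂ x))) :=
  (h.hu.mul h.hu₁).sub (h.hu.mul (h.hu.mul h.hu₁))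

theorem toL2_eq (h : EquationAt lam u u₁ u₂ u₃ M) :
    toL2 M = (-lam) • toL2 (fun x => u x - u₂ x) - toL2 (fun x => u x * (u₁ x - u₃ x))
      + toL2 fun x => 3 * (u x * u₁ x - u x * (u x * u₁ x)) - 2 * (u₁ x * (u x - u₂ x)) := by
  have h1 := h.hm.1.const_mul (-lam)
  have h2 := h.hm.2.mul_of_hasL2Deriv h.hu
  rw [← toL2_const_mul _ h.hm.1, ← toL2_sub h1 h2, ← toL2_add (f := fun x => -lam * (u x - u₂ x) - u x * (u₁ x - u₃ x)) (h1.sub h2)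
    (((h.hf.const_mul 3).sub ((h.hu₁.mul h.hm).const_mul 2)).1)]
  refine toL2_congr ?_
  filter_upwards [h.eq] with x hx
  linear_combination hx

theorem toL2_eq' (h : EquationAt lam u u₁ u₂ u₃ M) :
    toL2 M = (-lam) • toL2 (fun x => u x - u₂ x) - toL2 (fun x => u x * (u₁ x - u₃ x))
      + ((3 : ℝ) • toL2 (fun x => u x * u₁ x - u x * (u x * u₁ x))
        - (2 : ℝ) • toL2 (fun x => u₁ x * (u x - u₂ x))) := by
  rw [h.toL2_eq, toL2_sub (h.hf.const_mul 3).1 ((h.hu₁.mul h.hm).const_mul 2).1,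
    toL2_const_mul 3 h.hf.1, toL2_const_mul 2 (h.hu₁.mul h.hm).1]

/-- The energy identity in `H¹`. -/
theorem inner_add_inner {v v₁ v₂ : ℝ → ℝ}
    (h : EquationAt lam u u₁ u₂ u₃ fun x => v x - v₂ x) (hv : HasL2Deriv v v₁)
    (hv₁ : HasL2Deriv v₁ v₂) :
    inner ℝ (toL2 u) (toL2 v) + inner ℝ (toL2 u₁) (toL2 v₁)
      = -lam * (‖toL2 u‖ ^ 2 + ‖toL2 u₁‖ ^ 2) := by
  have h1 : inner ℝ (toL2 u₁) (toL2 v₁) = -inner ℝ (toL2 u) (toL2 v₂) := by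
    rw [inner_toL2 h.hu.2 hv₁.1, inner_toL2 h.hu.1 hv₁.2, h.hu.integral_mul_deriv hv₁, neg_neg]
  have h2 : inner ℝ (toL2 u) (toL2 u₂) = -‖toL2 u₁‖ ^ 2 := by
    rw [← real_inner_self_eq_norm_sq, inner_toL2 h.hu₁.1 h.hu₁.1, inner_toL2 h.hu.1 h.hu₁.2,
      h.hu.integral_mul_deriv h.hu₁]
  have h3 : inner ℝ (toL2 u) (toL2 fun x => u x * (u₁ x - u₃ x))
      = -2 * inner ℝ (toL2 u) (toL2 fun x => u₁ x * (u x - u₂ x)) := by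
    have := (h.hu.mul h.hu).integral_mul_deriv h.hm
    rw [inner_toL2 h.hu.1 (h.hm.2.mul_of_hasL2Deriv h.hu),
      inner_toL2 h.hu.1 (h.hm.1.mul_of_hasL2Deriv h.hu₁), ← integral_const_mul]
    simp only [mul_assoc] at this
    rw [this, ← integral_neg]
    congr 1; funext x; ring
  have h4 : inner ℝ (toL2 u) (toL2 fun x => u x * u₁ x) = 0 := by
    rw [h.hu.inner_mul_deriv h.hu]
    have := h.hu.inner_sq_eq_zero
    rw [inner_toL2 h.hu.2 (h.hu.mul h.hu).1] at this
    rw [inner_toL2 h.hu.1 (h.hu.1.mul_of_hasL2Deriv h.hu₁)]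
    have e : ∫ x, u x * (u₁ x * u x) = ∫ x, u₁ x * (u x * u x) := by
      congr 1; funext x; ring
    rw [e, this, mul_zero]
  -- Integrating u² (u²)' by parts reproduces it with the opposite sign.
  have h5 : inner ℝ (toL2 u) (toL2 fun x => u x * (u x * u₁ x)) = 0 := by
    have := (h.hu.mul h.hu).integral_mul_deriv (h.hu.mul h.hu)
    have e1 : ∫ x, u x * u x * (u₁ x * u x + u x * u₁ x)
        = 2 * ∫ x, u x * (u x * (u x * u₁ x)) := by
      rw [← integral_const_mul]
      congr 1; funext x; ring
    have e2 : ∫ x, (u₁ x * u x + u x * u₁ x) * (u x * u x)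
        = 2 * ∫ x, u x * (u x * (u x * u₁ x)) := by
      rw [← integral_const_mul]
      congr 1; funext x; ring
    rw [inner_toL2 h.hu.1 (h.hu.mul (h.hu.mul h.hu₁)).1]
    linarith
  -- By h3 the transport term contributes 2⟨u, u_x m⟩, which cancels the stretching term -2⟨u, u_x
  -- m⟩; h4 and h5 remove the rest, leaving only the linear term.
  have h6 := congrArg (inner ℝ (toL2 u)) h.toL2_eq'
  rw [toL2_sub hv.1 hv₁.2] at h6
  simp only [inner_add_right, inner_sub_right, real_inner_smul_right,
    toL2_sub h.hu.1 h.hu₂.1, toL2_sub (h.hu.mul h.hu₁).1 (h.hu.mul (h.hu.mul h.hu₁)).1,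
    h3, h4, h5, h2, real_inner_self_eq_norm_sq] at h6
  linarith

theorem norm_hf_le (h : EquationAt lam u u₁ u₂ u₃ M) (hA : ∀ᵐ x, |u x| ≤ A) :
    ‖toL2 fun x => u x * u₁ x - u x * (u x * u₁ x)‖ ≤ (A + A ^ 2) * ‖toL2 u₁‖ := by
  refine norm_toL2_le_mul h.hf.1 h.hu.2 ?_
  filter_upwards [hA] with x hx
  have hA0 : 0 ≤ A := (abs_nonneg _).trans hx
  have e : u x * u₁ x - u x * (u x * u₁ x) = (u x * (1 - u x)) * u₁ x := by ring
  rw [e, abs_mul, abs_mul]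
  refine mul_le_mul_of_nonneg_right ?_ (abs_nonneg _)
  have : |1 - u x| ≤ 1 + A := by
    rw [abs_le] at hx ⊢; constructor <;> linarith
  nlinarith [abs_nonneg (u x), abs_nonneg (1 - u x)]

theorem norm_hf_deriv_le (h : EquationAt lam u u₁ u₂ u₃ M) (hA : ∀ᵐ x, |u x| ≤ A) :
    ‖toL2 fun x => u₁ x * u₁ x + u x * u₂ x
        - (u₁ x * (u x * u₁ x) + u x * (u₁ x * u₁ x + u x * u₂ x))‖
      ≤ (1 + 2 * A) * (‖toL2 u₁‖ + ‖toL2 u₂‖) * ‖toL2 u₁‖ + (A + A ^ 2) * ‖toL2 u₂‖ := by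
  have hm1 : AEStronglyMeasurable (fun x => (1 - 2 * u x) * u₁ x) volume :=
    (aestronglyMeasurable_const.sub (h.hu.1.1.const_mul 2)).mul h.hu₁.1.1
  have hm2 : AEStronglyMeasurable (fun x => u x * (1 - u x)) volume :=
    h.hu.1.1.mul (aestronglyMeasurable_const.sub h.hu.1.1)
  have hb1 : ∀ᵐ x, |(1 - 2 * u x) * u₁ x| ≤ (1 + 2 * A) * (‖toL2 u₁‖ + ‖toL2 u₂‖) := by
    filter_upwards [hA, h.hu₁.ae_abs_le] with x hx hx1
    rw [abs_mul]
    have : |1 - 2 * u x| ≤ 1 + 2 * A := by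
      rw [abs_le] at hx ⊢; constructor <;> linarith
    exact mul_le_mul this hx1 (abs_nonneg _) ((abs_nonneg _).trans this)
  have hb2 : ∀ᵐ x, |u x * (1 - u x)| ≤ A + A ^ 2 := by
    filter_upwards [hA] with x hx
    have hA0 : 0 ≤ A := (abs_nonneg _).trans hx
    rw [abs_mul]
    have : |1 - u x| ≤ 1 + A := by
      rw [abs_le] at hx ⊢; constructor <;> linarith
    nlinarith [abs_nonneg (u x), abs_nonneg (1 - u x)]
  have e : (fun x => u₁ x * u₁ x + u x * u₂ x
        - (u₁ x * (u x * u₁ x) + u x * (u₁ x * u₁ x + u x * u₂ x)))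
      = fun x => ((1 - 2 * u x) * u₁ x) * u₁ x + (u x * (1 - u x)) * u₂ x := by
    funext x; ring
  rw [e, toL2_add (h.hu.2.bdd_mul_of_ae hm1 hb1) (h.hu₁.2.bdd_mul_of_ae hm2 hb2)]
  exact (norm_add_le _ _).trans
    (add_le_add (norm_toL2_mul_le h.hu.2 hm1 hb1) (norm_toL2_mul_le h.hu₁.2 hm2 hb2))

/-- The energy estimate for `m = u - u_xx` in `L²`. -/
theorem inner_le (h : EquationAt lam u u₁ u₂ u₃ M) (hk : ∀ᵐ x, -k < u₁ x)
    (hA : ∀ᵐ x, |u x| ≤ A) (hA' : ‖toL2 u₁‖ ≤ A) :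
    2 * inner ℝ (toL2 fun x => u x - u₂ x) (toL2 M)
      ≤ (2 * |lam| + 3 * k + 3) * ‖toL2 fun x => u x - u₂ x‖ ^ 2
        + 3 * ((A + A ^ 2) * A) ^ 2 := by
  have hA0 : 0 ≤ A := (norm_nonneg _).trans hA'
  have h1 := h.hu.inner_mul_deriv h.hm
  have h2 := neg_mul_norm_sq_le_inner h.hm.1 h.hu₁ hk
  have h3 := real_inner_le_norm (toL2 fun x => u x - u₂ x)
    (toL2 fun x => u x * u₁ x - u x * (u x * u₁ x))
  have h4 : ‖toL2 fun x => u x * u₁ x - u x * (u x * u₁ x)‖ ≤ (A + A ^ 2) * A :=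
    (h.norm_hf_le hA).trans (by gcongr)
  rw [h.toL2_eq']
  simp only [inner_add_right, inner_sub_right, real_inner_smul_right, h1,
    real_inner_self_eq_norm_sq]
  set y := ‖toL2 fun x => u x - u₂ x‖
  set F := ‖toL2 fun x => u x * u₁ x - u x * (u x * u₁ x)‖
  have h5 : F ^ 2 ≤ ((A + A ^ 2) * A) ^ 2 := by gcongr
  have h6 := neg_abs_le lam
  -- Transport gives +1 and stretching -4 times ∫ u_x m², so -3 in total, whence 3k; the coupling
  -- 6yF is split as 3y² + 3F².
  nlinarith [sq_nonneg (y - F), sq_nonneg y]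

theorem hp (h : EquationAt lam u u₁ u₂ u₃ M) :
    HasL2Deriv (fun x => 3 * (u x * u₁ x - u x * (u x * u₁ x)) - 2 * (u₁ x * (u x - u₂ x)))
      (fun x => 3 * (u₁ x * u₁ x + u x * u₂ x
        - (u₁ x * (u x * u₁ x) + u x * (u₁ x * u₁ x + u x * u₂ x)))
        - 2 * (u₂ x * (u x - u₂ x) + u₁ x * (u₁ x - u₃ x))) :=
  (h.hf.const_mul 3).sub ((h.hu₁.mul h.hm).const_mul 2)

/-- The energy production of the difference quotients of `m = u - u_xx`. -/
theorem inner_diffQuot (h : EquationAt lam u u₁ u₂ u₃ M) (s : ℝ) :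
    inner ℝ (toL2 (diffQuot s fun x => u x - u₂ x)) (toL2 (diffQuot s M))
      = -lam * ‖toL2 (diffQuot s fun x => u x - u₂ x)‖ ^ 2
        - inner ℝ (toL2 (diffQuot s fun x => u x - u₂ x))
            (toL2 fun x => diffQuot s u x * (fun x => u₁ x - u₃ x) (x + s))
        + 1 / 2 * inner ℝ (toL2 (diffQuot s fun x => u x - u₂ x))
            (toL2 fun x => u₁ x * diffQuot s (fun x => u x - u₂ x) x)
        + inner ℝ (toL2 (diffQuot s fun x => u x - u₂ x)) (toL2 (diffQuot s
            fun x => 3 * (u x * u₁ x - u x * (u x * u₁ x)) - 2 * (u₁ x * (u x - u₂ x)))) := by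
  have hun := h.hm.2.mul_of_hasL2Deriv h.hu
  have h1 : toL2 (diffQuot s M) = (-lam) • toL2 (diffQuot s fun x => u x - u₂ x)
      - toL2 (diffQuot s fun x => u x * (u₁ x - u₃ x)) + toL2 (diffQuot s
        fun x => 3 * (u x * u₁ x - u x * (u x * u₁ x)) - 2 * (u₁ x * (u x - u₂ x))) := by
    rw [toL2_diffQuot h.memLp, toL2_diffQuot h.hm.1, toL2_diffQuot hun, toL2_diffQuot h.hp.1,
      h.toL2_eq]
    simp only [map_add, map_sub, map_smul]
    module
  have h2 : toL2 (diffQuot s fun x => u x * (u₁ x - u₃ x))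
      = toL2 (fun x => diffQuot s u x * (fun x => u₁ x - u₃ x) (x + s))
        + toL2 (fun x => u x * diffQuot s (fun x => u₁ x - u₃ x) x) := by
    rw [← toL2_add ((h.hm.2.shift s).mul_of_hasL2Deriv (h.hu.diffQuot s))
      ((h.hm.2.diffQuot s).mul_of_hasL2Deriv h.hu)]
    congr 1; funext x
    simp only [diffQuot]
    ring
  -- For a fixed step the difference quotient of m is in H¹, so this integration by parts is
  -- legitimate, although it would not be for m_x itself.
  have h3 := h.hu.inner_mul_deriv (h.hm.diffQuot s)
  rw [h1, h2]
  simp only [inner_add_right, inner_sub_right, real_inner_smul_right, h3,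
    real_inner_self_eq_norm_sq]
  ring

/-- The limit of the energy production of the difference quotients. -/
noncomputable def production (lam : ℝ) (u u₁ u₂ u₃ : ℝ → ℝ) : ℝ :=
  -lam * ‖toL2 fun x => u₁ x - u₃ x‖ ^ 2
    - 5 / 2 * inner ℝ (toL2 fun x => u₁ x - u₃ x) (toL2 fun x => u₁ x * (u₁ x - u₃ x))
    + inner ℝ (toL2 fun x => u x - u₂ x) (toL2 fun x => u₁ x * (u x - u₂ x))
    + 3 * inner ℝ (toL2 fun x => u₁ x - u₃ x) (toL2 fun x => u₁ x * u₁ x + u x * u₂ x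
        - (u₁ x * (u x * u₁ x) + u x * (u₁ x * u₁ x + u x * u₂ x)))

theorem toL2_hp_deriv (h : EquationAt lam u u₁ u₂ u₃ M) :
    toL2 (fun x => 3 * (u₁ x * u₁ x + u x * u₂ x
        - (u₁ x * (u x * u₁ x) + u x * (u₁ x * u₁ x + u x * u₂ x)))
        - 2 * (u₂ x * (u x - u₂ x) + u₁ x * (u₁ x - u₃ x)))
      = (3 : ℝ) • toL2 (fun x => u₁ x * u₁ x + u x * u₂ x
        - (u₁ x * (u x * u₁ x) + u x * (u₁ x * u₁ x + u x * u₂ x)))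
        - (2 : ℝ) • (toL2 (fun x => u₂ x * (u x - u₂ x))
          + toL2 (fun x => u₁ x * (u₁ x - u₃ x))) := by
  rw [toL2_sub (h.hf.const_mul 3).2 ((h.hu₁.mul h.hm).const_mul 2).2,
    toL2_const_mul 3 h.hf.2, toL2_const_mul 2 (h.hu₁.mul h.hm).2,
    toL2_add (h.hm.1.mul_of_hasL2Deriv h.hu₂) (h.hm.2.mul_of_hasL2Deriv h.hu₁)]

/-- Writing u₂ = u - m removes the second derivative: ∫ m² m_x = 0, and ∫ u m m_x is integrated by
parts. -/
theorem inner_u₂_mul (h : EquationAt lam u u₁ u₂ u₃ M) :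
    inner ℝ (toL2 fun x => u₁ x - u₃ x) (toL2 fun x => u₂ x * (u x - u₂ x))
      = -(1 / 2) * inner ℝ (toL2 fun x => u x - u₂ x) (toL2 fun x => u₁ x * (u x - u₂ x)) := by
  have e : (fun x => u₂ x * (u x - u₂ x))
      = fun x => u x * (u x - u₂ x) - (u x - u₂ x) * (u x - u₂ x) := by
    funext x; ring
  have hum := h.hm.1.mul_of_hasL2Deriv h.hu
  rw [e, toL2_sub hum (h.hm.mul h.hm).1, inner_sub_right, h.hm.inner_sq_eq_zero, sub_zero,
    ← h.hu.inner_mul_deriv h.hm, inner_toL2 h.hm.2 hum,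
    inner_toL2 h.hm.1 (h.hm.2.mul_of_hasL2Deriv h.hu)]
  congr 1; funext x; ring

theorem tendsto_inner_diffQuot (h : EquationAt lam u u₁ u₂ u₃ M) :
    Tendsto (fun s => inner ℝ (toL2 (diffQuot s fun x => u x - u₂ x)) (toL2 (diffQuot s M)))
      (𝓝[≠] 0) (𝓝 (production lam u u₁ u₂ u₃)) := by
  have hw := h.hm.tendsto_diffQuot
  have h1 := h.hu.tendsto_diffQuot_mul_shift h.hu₁ h.hm.2
  have h2 := h.hu₁.tendsto_mul (fun s => h.hm.1.diffQuot s) h.hm.2 hw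
  have h3 := h.hp.tendsto_diffQuot
  have hlim := ((((hw.norm.pow 2).const_mul (-lam)).sub (hw.inner h1)).add
    ((hw.inner h2).const_mul (1 / 2))).add (hw.inner h3)
  simp only [h.inner_diffQuot]
  convert hlim using 2
  rw [h.toL2_hp_deriv, production]
  simp only [inner_add_right, inner_sub_right, real_inner_smul_right, h.inner_u₂_mul]
  ring

/-- The one-sided bound on u₁ is used for the term quadratic in m_x, so that its coefficient does
not depend on time. The term ∫ u₁ m² is instead bounded by the Sobolev inequality, since u₂ and m
are already under control at that stage. -/
theorem production_le (h : EquationAt lam u u₁ u₂ u₃ M) (hk : ∀ᵐ x, -k < u₁ x)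
    (hA : ∀ᵐ x, |u x| ≤ A) :
    2 * production lam u u₁ u₂ u₃
      ≤ (2 * |lam| + 5 * k + 3) * ‖toL2 fun x => u₁ x - u₃ x‖ ^ 2
        + 2 * ((‖toL2 u₁‖ + ‖toL2 u₂‖) * ‖toL2 fun x => u x - u₂ x‖ ^ 2)
        + 3 * ((1 + 2 * A) * (‖toL2 u₁‖ + ‖toL2 u₂‖) * ‖toL2 u₁‖
            + (A + A ^ 2) * ‖toL2 u₂‖) ^ 2 := by
  have h2 := neg_mul_norm_sq_le_inner h.hm.2 h.hu₁ hk
  have h3 := real_inner_le_norm (toL2 fun x => u₁ x - u₃ x)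
    (toL2 fun x => u₁ x * u₁ x + u x * u₂ x
        - (u₁ x * (u x * u₁ x) + u x * (u₁ x * u₁ x + u x * u₂ x)))
  have h4 := h.norm_hf_deriv_le hA
  have h5 : inner ℝ (toL2 fun x => u x - u₂ x) (toL2 fun x => u₁ x * (u x - u₂ x))
      ≤ (‖toL2 u₁‖ + ‖toL2 u₂‖) * ‖toL2 fun x => u x - u₂ x‖ ^ 2 := by
    refine (real_inner_le_norm _ _).trans ?_
    have := h.hu₁.norm_mul_le h.hm.1
    nlinarith [norm_nonneg (toL2 fun x => u x - u₂ x)]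
  rw [production]
  set φ := ‖toL2 fun x => u₁ x - u₃ x‖
  set F := ‖toL2 fun x => u₁ x * u₁ x + u x * u₂ x
        - (u₁ x * (u x * u₁ x) + u x * (u₁ x * u₁ x + u x * u₂ x))‖
  have h6 : F ^ 2 ≤ ((1 + 2 * A) * (‖toL2 u₁‖ + ‖toL2 u₂‖) * ‖toL2 u₁‖
            + (A + A ^ 2) * ‖toL2 u₂‖) ^ 2 := by gcongr
  have h7 := neg_abs_le lam
  nlinarith [sq_nonneg (φ - F), sq_nonneg φ]

/-- The energy production of the difference quotients is bounded uniformly in the step. -/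
theorem abs_inner_diffQuot_le {B : ℝ} (h : EquationAt lam u u₁ u₂ u₃ M)
    (h0 : ‖toL2 u‖ ≤ B) (h1 : ‖toL2 u₁‖ ≤ B) (h2 : ‖toL2 u₂‖ ≤ B) (h3 : ‖toL2 u₃‖ ≤ B) (s : ℝ) :
    |inner ℝ (toL2 (diffQuot s fun x => u x - u₂ x)) (toL2 (diffQuot s M))|
      ≤ |lam| * (2 * B) ^ 2 + 2 * B * (2 * B * (2 * B)) + 1 / 2 * (2 * B * (2 * B * (2 * B)))
        + 2 * B * (3 * ((1 + 2 * (2 * B)) * (2 * B) * B + (2 * B + (2 * B) ^ 2) * B)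
          + 2 * (2 * B * (2 * B) + 2 * B * (2 * B))) := by
  have hB : 0 ≤ B := (norm_nonneg _).trans h0
  have hm : ‖toL2 fun x => u x - u₂ x‖ ≤ 2 * B := by
    rw [toL2_sub h.hu.1 h.hu₂.1]
    linarith [norm_sub_le (toL2 u) (toL2 u₂)]
  have hn : ‖toL2 fun x => u₁ x - u₃ x‖ ≤ 2 * B := by
    rw [toL2_sub h.hu.2 h.hu₂.2]
    linarith [norm_sub_le (toL2 u₁) (toL2 u₃)]
  have hw := (h.hm.norm_diffQuot_le s).trans hn
  have hA : ∀ᵐ x, |u x| ≤ 2 * B := by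
    filter_upwards [h.hu.ae_abs_le] with x hx
    linarith
  have e1 : ‖toL2 fun x => diffQuot s u x * (fun x => u₁ x - u₃ x) (x + s)‖
      ≤ 2 * B * (2 * B) := by
    refine ((h.hu.diffQuot s).norm_mul_le (h.hm.2.shift s)).trans ?_
    rw [toL2_shift h.hm.2, LinearIsometry.norm_map]
    have := h.hu.norm_diffQuot_le s
    have := h.hu₁.norm_diffQuot_le s
    gcongr
    linarith
  have e2 : ‖toL2 fun x => u₁ x * diffQuot s (fun x => u x - u₂ x) x‖ ≤ 2 * B * (2 * B) := by
    refine (h.hu₁.norm_mul_le (h.hm.1.diffQuot s)).trans ?_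
    gcongr
    linarith
  have e3 := h.hp.norm_diffQuot_le s
  rw [h.toL2_hp_deriv] at e3
  have e4 : ‖toL2 fun x => u₂ x * (u x - u₂ x)‖ ≤ 2 * B * (2 * B) := by
    refine (h.hu₂.norm_mul_le h.hm.1).trans ?_
    gcongr
    linarith
  have e5 : ‖toL2 fun x => u₁ x * (u₁ x - u₃ x)‖ ≤ 2 * B * (2 * B) := by
    refine (h.hu₁.norm_mul_le h.hm.2).trans ?_
    gcongr
    linarith
  have e6 : ‖toL2 fun x => u₁ x * u₁ x + u x * u₂ x
        - (u₁ x * (u x * u₁ x) + u x * (u₁ x * u₁ x + u x * u₂ x))‖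
      ≤ (1 + 2 * (2 * B)) * (2 * B) * B + (2 * B + (2 * B) ^ 2) * B := by
    refine (h.norm_hf_deriv_le hA).trans ?_
    gcongr
    linarith
  replace e3 := e3.trans (norm_sub_le _ _)
  rw [norm_smul, norm_smul, Real.norm_ofNat, Real.norm_ofNat] at e3
  replace e3 : ‖toL2 (diffQuot s
        fun x => 3 * (u x * u₁ x - u x * (u x * u₁ x)) - 2 * (u₁ x * (u x - u₂ x)))‖
      ≤ 3 * ((1 + 2 * (2 * B)) * (2 * B) * B + (2 * B + (2 * B) ^ 2) * B)
        + 2 * (2 * B * (2 * B) + 2 * B * (2 * B)) := by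
    refine e3.trans ?_
    gcongr
    exact (norm_add_le _ _).trans (add_le_add e4 e5)
  rw [h.inner_diffQuot]
  have i1 := (abs_real_inner_le_norm _ _).trans
    (mul_le_mul hw e1 (norm_nonneg _) (by positivity))
  have i2 := (abs_real_inner_le_norm _ _).trans
    (mul_le_mul hw e2 (norm_nonneg _) (by positivity))
  have i3 := (abs_real_inner_le_norm _ _).trans
    (mul_le_mul hw e3 (norm_nonneg _) (by positivity))
  have i0 : |-lam * ‖toL2 (diffQuot s fun x => u x - u₂ x)‖ ^ 2| ≤ |lam| * (2 * B) ^ 2 := by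
    rw [abs_mul, abs_neg, abs_of_nonneg (sq_nonneg ‖toL2 (diffQuot s fun x => u x - u₂ x)‖)]
    gcongr
  refine (abs_add_le _ _).trans (add_le_add ((abs_add_le _ _).trans (add_le_add
    ((abs_sub _ _).trans (add_le_add i0 i1)) ?_)) i3)
  rw [abs_mul, abs_of_nonneg (by norm_num : (0 : ℝ) ≤ 1 / 2)]
  gcongr

end EquationAt

/-! ### Sobolev spaces of integer order as curves in L² -/

namespace MemSobolevH

variable {n : ℕ} {f g : ℝ → ℝ}

theorem memLp : ∀ {n : ℕ} {f : ℝ → ℝ}, MemSobolevH n f → MemLp f 2 volume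
  | 0, _, h => h
  | _ + 1, _, h => h.1

theorem congr (h : MemSobolevH n f) (hfg : f =ᵐ[volume] g) : MemSobolevH n g := by
  cases n with
  | zero => exact (memLp_congr_ae hfg).1 h
  | succ n =>
    obtain ⟨h1, f', h2, h3⟩ := h
    exact ⟨(memLp_congr_ae hfg).1 h1, f', h2.congr hfg (ae_eq_refl _), h3⟩

theorem weakDeriv (h : MemSobolevH (n + 1) f) : MemSobolevH n (weakDeriv f) := by
  obtain ⟨h1, f', h2, h3⟩ := h
  exact h3.congr h2.weakDeriv_ae_eq.symm

theorem hasL2Deriv (h : MemSobolevH (n + 1) f) : HasL2Deriv f (_root_.weakDeriv f) :=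
  ⟨h.memLp, h.weakDeriv.memLp, h.2.choose_spec.1.weakDeriv⟩

theorem of_succ : ∀ {n : ℕ} {f : ℝ → ℝ}, MemSobolevH (n + 1) f → MemSobolevH n f
  | 0, _, h => h.1
  | _ + 1, _, h => ⟨h.1, _, h.hasL2Deriv.hasWeakDeriv, h.weakDeriv.of_succ⟩

theorem memLp_iterate {j : ℕ} : ∀ {n : ℕ} {f : ℝ → ℝ}, MemSobolevH n f → j ≤ n →
    MemLp (_root_.weakDeriv^[j] f) 2 volume := by
  induction j with
  | zero => exact fun h _ => h.memLp
  | succ j ih =>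
    intro n f h hj
    obtain ⟨n, rfl⟩ := Nat.exists_eq_add_of_lt hj
    have h' : MemSobolevH ((j + n) + 1) f := h
    exact ih h'.weakDeriv (Nat.le_add_right _ _)

theorem linearCombination (a b : ℝ) : ∀ {n : ℕ} {f g : ℝ → ℝ}, MemSobolevH n f →
    MemSobolevH n g → MemSobolevH n fun x => a * f x + b * g x
  | 0, _, _, hf, hg => (MemLp.const_mul hf a).add (MemLp.const_mul hg b)
  | _ + 1, _, _, hf, hg => by
    have h := (hf.hasL2Deriv.const_mul a).add (hg.hasL2Deriv.const_mul b)
    exact ⟨h.memLp, _, h.hasWeakDeriv, linearCombination a b hf.weakDeriv hg.weakDeriv⟩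

end MemSobolevH

theorem iterate_weakDeriv_congr {f g : ℝ → ℝ} (h : f =ᵐ[volume] g) (j : ℕ) :
    weakDeriv^[j] f =ᵐ[volume] weakDeriv^[j] g := by
  cases j with
  | zero => exact h
  | succ j => rw [Function.iterate_succ_apply, Function.iterate_succ_apply, weakDeriv_congr h]

theorem iterate_weakDeriv_linearCombination (a b : ℝ) (j : ℕ) : ∀ {n : ℕ} {f g : ℝ → ℝ},
    MemSobolevH n f → MemSobolevH n g → j ≤ n →
    weakDeriv^[j] (fun x => a * f x + b * g x)
      =ᵐ[volume] fun x => a * weakDeriv^[j] f x + b * weakDeriv^[j] g x := by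
  induction j with
  | zero => exact fun _ _ _ => ae_eq_refl _
  | succ j ih =>
    intro n f g hf hg hj
    obtain ⟨n, rfl⟩ := Nat.exists_eq_add_of_lt hj
    have hf' : MemSobolevH ((j + n) + 1) f := hf
    have hg' : MemSobolevH ((j + n) + 1) g := hg
    have h := (hf'.hasL2Deriv.const_mul a).add (hg'.hasL2Deriv.const_mul b)
    rw [Function.iterate_succ_apply]
    exact (iterate_weakDeriv_congr h.hasWeakDeriv.weakDeriv_ae_eq j).trans
      (ih hf'.weakDeriv hg'.weakDeriv (Nat.le_add_right _ _))

theorem toL2_iterate_weakDeriv_linearCombination (a b : ℝ) {j n : ℕ} {f g : ℝ → ℝ}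
    (hf : MemSobolevH n f) (hg : MemSobolevH n g) (hj : j ≤ n) :
    toL2 (weakDeriv^[j] fun x => a * f x + b * g x)
      = a • toL2 (weakDeriv^[j] f) + b • toL2 (weakDeriv^[j] g) := by
  have hf' := hf.memLp_iterate hj
  have hg' := hg.memLp_iterate hj
  rw [toL2_congr (iterate_weakDeriv_linearCombination a b j hf hg hj),
    toL2_add (hf'.const_mul a) (hg'.const_mul b), toL2_const_mul a hf', toL2_const_mul b hg']

theorem sobolevNorm_eq {n : ℕ} {f : ℝ → ℝ} (hf : MemSobolevH n f) :
    sobolevNorm n f = √(∑ j ∈ Finset.range (n + 1),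
      (n.choose j : ℝ) * ‖toL2 (weakDeriv^[j] f)‖ ^ 2) := by
  rw [sobolevNorm]
  congr 1
  refine Finset.sum_congr rfl fun j hj => ?_
  rw [norm_toL2_sq (hf.memLp_iterate (Finset.mem_range_succ_iff.1 hj))]

theorem norm_iterate_weakDeriv_le_sobolevNorm {j n : ℕ} {f : ℝ → ℝ} (hf : MemSobolevH n f)
    (hj : j ≤ n) : ‖toL2 (weakDeriv^[j] f)‖ ≤ sobolevNorm n f := by
  rw [sobolevNorm_eq hf]
  refine Real.le_sqrt_of_sq_le ?_
  have h1 := Finset.single_le_sum (f := fun j => (n.choose j : ℝ) * ‖toL2 (weakDeriv^[j] f)‖ ^ 2)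
    (fun _ _ => by positivity) (Finset.mem_range_succ_iff.2 hj)
  refine le_trans ?_ h1
  have : (1 : ℝ) ≤ n.choose j := by exact_mod_cast Nat.choose_pos hj
  nlinarith [sq_nonneg ‖toL2 (weakDeriv^[j] f)‖]

theorem ContinuousInSobolev.continuousOn {n j : ℕ} {I : Set ℝ} {u : ℝ → ℝ → ℝ}
    (h : ContinuousInSobolev n I u) (hj : j ≤ n) :
    ContinuousOn (fun t => toL2 (weakDeriv^[j] (u t))) I := by
  intro s hs
  rw [ContinuousWithinAt, tendsto_iff_norm_sub_tendsto_zero]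
  refine squeeze_zero' (Eventually.of_forall fun _ => norm_nonneg _) ?_ (h.2 s hs)
  filter_upwards [self_mem_nhdsWithin] with t ht
  have e : (fun x => u t x - u s x) = fun x => 1 * u t x + (-1) * u s x := by
    funext x; ring
  have h1 := norm_iterate_weakDeriv_le_sobolevNorm
    ((h.1 t ht).linearCombination 1 (-1) (h.1 s hs)) hj
  rw [toL2_iterate_weakDeriv_linearCombination 1 (-1) (h.1 t ht) (h.1 s hs) hj] at h1
  rw [e]
  refine le_of_eq_of_le (congrArg norm ?_) h1
  module

theorem HasTimeDerivInSobolev.hasDerivWithinAt {n j : ℕ} {I : Set ℝ} {u v : ℝ → ℝ → ℝ}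
    (h : HasTimeDerivInSobolev n I u v) (hu : ∀ t ∈ I, MemSobolevH n (u t))
    (hv : ∀ t ∈ I, MemSobolevH n (v t)) (hj : j ≤ n) {s : ℝ} (hs : s ∈ I) :
    HasDerivWithinAt (fun t => toL2 (weakDeriv^[j] (u t))) (toL2 (weakDeriv^[j] (v s))) I s := by
  rw [hasDerivWithinAt_iff_tendsto_slope, tendsto_iff_norm_sub_tendsto_zero]
  refine squeeze_zero' (Eventually.of_forall fun _ => norm_nonneg _) ?_ (h s hs)
  filter_upwards [self_mem_nhdsWithin] with t ht
  have e : (fun x => (u t x - u s x) / (t - s) - v s x) = fun x =>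
      (t - s)⁻¹ * (fun x => 1 * u t x + (-1) * u s x) x + (-1) * v s x := by
    funext x; ring
  have h0 := (hu t ht.1).linearCombination 1 (-1) (hu s hs)
  have h1 := norm_iterate_weakDeriv_le_sobolevNorm
    (h0.linearCombination (t - s)⁻¹ (-1) (hv s hs)) hj
  rw [toL2_iterate_weakDeriv_linearCombination _ _ h0 (hv s hs) hj,
    toL2_iterate_weakDeriv_linearCombination 1 (-1) (hu t ht.1) (hu s hs) hj] at h1
  rw [e]
  refine le_of_eq_of_le (congrArg norm ?_) h1
  rw [slope_def_module]
  module

/-! ### Solution curves -/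

/-- A curve of solutions of the equation on the time interval `I`, together with the spatial
derivatives `u₁, u₂, u₃` of `u` and the time derivatives `v, v₁, v₂` of `u, u₁, u₂`. -/
structure SolutionCurve (lam : ℝ) (I : Set ℝ) (u u₁ u₂ u₃ v v₁ v₂ : ℝ → ℝ → ℝ) : Prop where
  equationAt : ∀ t ∈ I, EquationAt lam (u t) (u₁ t) (u₂ t) (u₃ t) fun x => v t x - v₂ t x
  hv : ∀ t ∈ I, HasL2Deriv (v t) (v₁ t)
  hv₁ : ∀ t ∈ I, HasL2Deriv (v₁ t) (v₂ t)
  continuousOn : ContinuousOn (fun t => toL2 (u t)) I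
  continuousOn₁ : ContinuousOn (fun t => toL2 (u₁ t)) I
  continuousOn₂ : ContinuousOn (fun t => toL2 (u₂ t)) I
  continuousOn₃ : ContinuousOn (fun t => toL2 (u₃ t)) I
  continuousOn_v : ContinuousOn (fun t => toL2 (v t)) I
  continuousOn_v₂ : ContinuousOn (fun t => toL2 (v₂ t)) I
  hasDeriv : ∀ t ∈ I, HasDerivWithinAt (fun t => toL2 (u t)) (toL2 (v t)) I t
  hasDeriv₁ : ∀ t ∈ I, HasDerivWithinAt (fun t => toL2 (u₁ t)) (toL2 (v₁ t)) I t
  hasDeriv₂ : ∀ t ∈ I, HasDerivWithinAt (fun t => toL2 (u₂ t)) (toL2 (v₂ t)) I t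

theorem SolutionCurve.mono {lam : ℝ} {I J : Set ℝ} {u u₁ u₂ u₃ v v₁ v₂ : ℝ → ℝ → ℝ}
    (h : SolutionCurve lam I u u₁ u₂ u₃ v v₁ v₂) (hJ : J ⊆ I) :
    SolutionCurve lam J u u₁ u₂ u₃ v v₁ v₂ where
  equationAt t ht := h.equationAt t (hJ ht)
  hv t ht := h.hv t (hJ ht)
  hv₁ t ht := h.hv₁ t (hJ ht)
  continuousOn := h.continuousOn.mono hJ
  continuousOn₁ := h.continuousOn₁.mono hJ
  continuousOn₂ := h.continuousOn₂.mono hJ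
  continuousOn₃ := h.continuousOn₃.mono hJ
  continuousOn_v := h.continuousOn_v.mono hJ
  continuousOn_v₂ := h.continuousOn_v₂.mono hJ
  hasDeriv t ht := (h.hasDeriv t (hJ ht)).mono hJ
  hasDeriv₁ t ht := (h.hasDeriv₁ t (hJ ht)).mono hJ
  hasDeriv₂ t ht := (h.hasDeriv₂ t (hJ ht)).mono hJ

theorem IsSolution.exists_solutionCurve {lam : ℝ} {T : EReal} {u₀ : ℝ → ℝ} {u : ℝ → ℝ → ℝ}
    (h : IsSolution lam T u₀ u) : ∃ v v₁ v₂, SolutionCurve lam (timeInterval T) u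
      (fun t => weakDeriv (u t)) (fun t => weakDeriv^[2] (u t)) (fun t => weakDeriv^[3] (u t))
      v v₁ v₂ := by
  obtain ⟨-, -, hu, v, hv, hd, heq⟩ := h
  have hu2 : ∀ t ∈ timeInterval T, MemSobolevH 2 (u t) := fun t ht => (hu.1 t ht).of_succ
  refine ⟨v, fun t => weakDeriv (v t), fun t => weakDeriv^[2] (v t), ?_⟩
  exact {
    equationAt := fun t ht => {
      hu := (hu.1 t ht).hasL2Deriv
      hu₁ := (hu.1 t ht).weakDeriv.hasL2Deriv
      hu₂ := (hu.1 t ht).weakDeriv.weakDeriv.hasL2Deriv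
      memLp := (hv.1 t ht).memLp.sub ((hv.1 t ht).memLp_iterate le_rfl)
      eq := heq t ht }
    hv := fun t ht => (hv.1 t ht).hasL2Deriv
    hv₁ := fun t ht => (hv.1 t ht).weakDeriv.hasL2Deriv
    continuousOn := hu.continuousOn (j := 0) (by norm_num)
    continuousOn₁ := hu.continuousOn (j := 1) (by norm_num)
    continuousOn₂ := hu.continuousOn (j := 2) (by norm_num)
    continuousOn₃ := hu.continuousOn (j := 3) (by norm_num)
    continuousOn_v := hv.continuousOn (j := 0) (by norm_num)
    continuousOn_v₂ := hv.continuousOn (j := 2) (by norm_num)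
    hasDeriv := fun t ht => hd.hasDerivWithinAt hu2 hv.1 (j := 0) (by norm_num) ht
    hasDeriv₁ := fun t ht => hd.hasDerivWithinAt hu2 hv.1 (j := 1) (by norm_num) ht
    hasDeriv₂ := fun t ht => hd.hasDerivWithinAt hu2 hv.1 (j := 2) (by norm_num) ht }

/-! ### Grönwall's inequality and passage to the limit -/

/-- Grönwall's inequality with exponential forcing. -/
theorem le_mul_exp_of_deriv_right_le {f f' : ℝ → ℝ} {b c β δ B K : ℝ}
    (hf : ContinuousOn f (Set.Icc 0 b))
    (hf' : ∀ t ∈ Set.Ico 0 b, HasDerivWithinAt f (f' t) (Set.Ici t) t)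
    (hle : ∀ t ∈ Set.Ico 0 b, f' t ≤ c * f t + β * Real.exp (δ * t)) (h0 : f 0 ≤ B)
    (hβ : 0 ≤ β) (hδ : δ ≤ K) (hK : c * B + β < K * B) :
    ∀ t ∈ Set.Icc 0 b, f t ≤ B * Real.exp (K * t) := by
  have hB : ∀ t, HasDerivAt (fun t => B * Real.exp (K * t)) (B * (Real.exp (K * t) * K)) t := by
    intro t
    have h1 : HasDerivAt (fun t => K * t) K t := by simpa using (hasDerivAt_id t).const_mul K
    exact h1.exp.const_mul B
  -- The derivatives need to be compared only where f touches the barrier B exp(Kt). There the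
  -- strict inequality in hK applies, and the forcing is at most β exp(Kt).
  refine image_le_of_deriv_right_lt_deriv_boundary hf hf' (by simpa using h0) hB ?_
  intro t ht hft
  refine (hle t ht).trans_lt ?_
  rw [hft]
  have h1 : Real.exp (δ * t) ≤ Real.exp (K * t) :=
    Real.exp_le_exp.2 (mul_le_mul_of_nonneg_right hδ ht.1)
  have h2 := Real.exp_pos (K * t)
  nlinarith [mul_le_mul_of_nonneg_left h1 hβ, mul_lt_mul_of_pos_right hK h2]

theorem le_integral_of_tendsto_of_bounded {ι : Type*} {l : Filter ι} [l.NeBot]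
    [l.IsCountablyGenerated] {g : ι → ℝ → ℝ} {P H : ℝ → ℝ} {t C L : ℝ} (ht : 0 ≤ t)
    (hg : ∀ i, ContinuousOn (g i) (Set.Icc 0 t)) (hH : ContinuousOn H (Set.Icc 0 t))
    (hC : ∀ i, ∀ s ∈ Set.Icc 0 t, |g i s| ≤ C)
    (hP : ∀ s ∈ Set.Icc 0 t, Tendsto (fun i => g i s) l (𝓝 (P s)))
    (hPH : ∀ s ∈ Set.Icc 0 t, P s ≤ H s)
    (hL : Tendsto (fun i => ∫ s in (0 : ℝ)..t, g i s) l (𝓝 L)) :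
    L ≤ ∫ s in (0 : ℝ)..t, H s := by
  have hsub : Set.uIoc 0 t ⊆ Set.Icc 0 t := by
    rw [Set.uIoc_of_le ht]; exact Set.Ioc_subset_Icc_self
  -- Replacing g by its maximum with H makes the pointwise limit equal to H, so neither
  -- measurability nor integrability of P is needed.
  have hmax : ∀ i, ContinuousOn (fun s => max (g i s) (H s)) (Set.Icc 0 t) := fun i =>
    (hg i).sup hH
  have h1 : Tendsto (fun i => ∫ s in (0 : ℝ)..t, max (g i s) (H s)) l
      (𝓝 (∫ s in (0 : ℝ)..t, H s)) := by
    refine intervalIntegral.tendsto_integral_filter_of_dominated_convergence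
      (fun s => C + |H s|) (Eventually.of_forall fun i => ?_) (Eventually.of_forall fun i => ?_)
      ?_ ?_
    · exact ((hmax i).mono hsub).aestronglyMeasurable measurableSet_uIoc
    · refine ae_of_all _ fun s hs => ?_
      have := hC i s (hsub hs)
      have h3 := abs_le.1 this
      rw [Real.norm_eq_abs, abs_le]
      rcases max_cases (g i s) (H s) with h | h <;> rw [h.1] <;>
        constructor <;> linarith [le_abs_self (H s), neg_abs_le (H s), abs_nonneg (H s)]
    · exact (continuousOn_const.add hH.abs).intervalIntegrable_of_Icc ht
    · refine ae_of_all _ fun s hs => ?_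
      have := (hP s (hsub hs)).max (tendsto_const_nhds (x := H s))
      rwa [max_eq_right (hPH s (hsub hs))] at this
  refine le_of_tendsto_of_tendsto' hL h1 fun i => ?_
  exact intervalIntegral.integral_mono_on ht ((hg i).intervalIntegrable_of_Icc ht)
    ((hmax i).intervalIntegrable_of_Icc ht) fun s _ => le_max_left _ _

theorem HasDerivWithinAt.Ici_of_Icc {E : Type*} [NormedAddCommGroup E] [NormedSpace ℝ E]
    {f : ℝ → E} {f' : E} {a b t : ℝ} (h : HasDerivWithinAt f f' (Set.Icc a b) t)
    (ht : t ∈ Set.Ico a b) : HasDerivWithinAt f f' (Set.Ici t) t :=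
  h.mono_of_mem_nhdsWithin (mem_of_superset (Icc_mem_nhdsGE ht.2)
    (Set.Icc_subset_Icc_left ht.1))

theorem HasL2Deriv.toL2_deriv_eq_zero {f g : ℝ → ℝ} (h : HasL2Deriv f g) (h0 : toL2 f = 0) :
    toL2 g = 0 := by
  have := h.hasDerivAt_shiftL2
  simp only [h0, map_zero] at this
  exact this.unique (hasDerivAt_const _ _)

theorem HasL2Deriv.norm_sub_sq {f f₁ f₂ : ℝ → ℝ} (h : HasL2Deriv f f₁) (h₁ : HasL2Deriv f₁ f₂) :
    ‖toL2 fun x => f x - f₂ x‖ ^ 2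
      = ‖toL2 f‖ ^ 2 + 2 * ‖toL2 f₁‖ ^ 2 + ‖toL2 f₂‖ ^ 2 := by
  have h2 : inner ℝ (toL2 f) (toL2 f₂) = -‖toL2 f₁‖ ^ 2 := by
    rw [← real_inner_self_eq_norm_sq, inner_toL2 h₁.1 h₁.1, inner_toL2 h.1 h₁.2,
      h.integral_mul_deriv h₁]
  rw [toL2_sub h.1 h₁.2, norm_sub_sq_real, h2]
  ring

/-! ### Energy estimates along a solution curve -/

namespace SolutionCurve

variable {lam k b : ℝ} {u u₁ u₂ u₃ v v₁ v₂ : ℝ → ℝ → ℝ}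

theorem continuousOn_m {I : Set ℝ} (h : SolutionCurve lam I u u₁ u₂ u₃ v v₁ v₂) :
    ContinuousOn (fun t => toL2 fun x => u t x - u₂ t x) I :=
  (h.continuousOn.sub h.continuousOn₂).congr fun t ht =>
    toL2_sub (h.equationAt t ht).hu.1 (h.equationAt t ht).hu₂.1

theorem continuousOn_n {I : Set ℝ} (h : SolutionCurve lam I u u₁ u₂ u₃ v v₁ v₂) :
    ContinuousOn (fun t => toL2 fun x => u₁ t x - u₃ t x) I :=
  (h.continuousOn₁.sub h.continuousOn₃).congr fun t ht =>
    toL2_sub (h.equationAt t ht).hu.2 (h.equationAt t ht).hu₂.2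

theorem continuousOn_M {I : Set ℝ} (h : SolutionCurve lam I u u₁ u₂ u₃ v v₁ v₂) :
    ContinuousOn (fun t => toL2 fun x => v t x - v₂ t x) I :=
  (h.continuousOn_v.sub h.continuousOn_v₂).congr fun t ht =>
    toL2_sub (h.hv t ht).1 (h.hv₁ t ht).2

theorem hasDeriv_m {I : Set ℝ} (h : SolutionCurve lam I u u₁ u₂ u₃ v v₁ v₂) {t : ℝ}
    (ht : t ∈ I) : HasDerivWithinAt (fun t => toL2 fun x => u t x - u₂ t x)
      (toL2 fun x => v t x - v₂ t x) I t := by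
  rw [toL2_sub (h.hv t ht).1 (h.hv₁ t ht).2]
  exact ((h.hasDeriv t ht).sub (h.hasDeriv₂ t ht)).congr
    (fun s hs => toL2_sub (h.equationAt s hs).hu.1 (h.equationAt s hs).hu₂.1)
    (toL2_sub (h.equationAt t ht).hu.1 (h.equationAt t ht).hu₂.1)

/-- The energy identity alone would allow the rate 2|λ|; the extra 1, like B > 0, supplies the
strict inequality of the barrier argument. -/
theorem energy_le (h : SolutionCurve lam (Set.Icc 0 b) u u₁ u₂ u₃ v v₁ v₂) {B : ℝ} (hB : 0 < B)
    (h0 : ‖toL2 (u 0)‖ ^ 2 + ‖toL2 (u₁ 0)‖ ^ 2 ≤ B) :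
    ∀ t ∈ Set.Icc 0 b, ‖toL2 (u t)‖ ^ 2 + ‖toL2 (u₁ t)‖ ^ 2
      ≤ B * Real.exp ((2 * |lam| + 1) * t) := by
  refine le_mul_exp_of_deriv_right_le (c := 2 * |lam|) (β := 0) (δ := 0)
    (f := fun t => ‖toL2 (u t)‖ ^ 2 + ‖toL2 (u₁ t)‖ ^ 2)
    (f' := fun t => 2 * inner ℝ (toL2 (u t)) (toL2 (v t))
      + 2 * inner ℝ (toL2 (u₁ t)) (toL2 (v₁ t)))
    ((h.continuousOn.norm.pow 2).add (h.continuousOn₁.norm.pow 2)) (fun t ht => ?_)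
    (fun t ht => ?_) h0 le_rfl (by positivity) (by nlinarith [abs_nonneg lam])
  · have ht' := Set.Ico_subset_Icc_self ht
    exact ((h.hasDeriv t ht').norm_sq.add (h.hasDeriv₁ t ht').norm_sq).Ici_of_Icc ht
  · have ht' := Set.Ico_subset_Icc_self ht
    have h1 := (h.equationAt t ht').inner_add_inner (h.hv t ht') (h.hv₁ t ht')
    have h2 := neg_abs_le lam
    nlinarith [sq_nonneg ‖toL2 (u t)‖, sq_nonneg ‖toL2 (u₁ t)‖]

/-- The integrated energy inequality for `n = m_x`, obtained from difference quotients. -/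
theorem norm_n_sq_le (h : SolutionCurve lam (Set.Icc 0 b) u u₁ u₂ u₃ v v₁ v₂) {H : ℝ → ℝ}
    (hH : ContinuousOn H (Set.Icc 0 b))
    (hle : ∀ t ∈ Set.Icc 0 b,
      2 * EquationAt.production lam (u t) (u₁ t) (u₂ t) (u₃ t) ≤ H t) {t : ℝ}
    (ht : t ∈ Set.Icc 0 b) :
    ‖toL2 fun x => u₁ t x - u₃ t x‖ ^ 2
      ≤ ‖toL2 fun x => u₁ 0 x - u₃ 0 x‖ ^ 2 + ∫ s in (0 : ℝ)..t, H s := by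
  have hsub : Set.Icc 0 t ⊆ Set.Icc 0 b := Set.Icc_subset_Icc_right ht.2
  -- This bound may depend on the curve and on b: it only dominates the energy production uniformly
  -- in the step and does not enter the final estimate.
  obtain ⟨B, hB⟩ : ∃ B, ∀ s ∈ Set.Icc 0 b, ‖toL2 (u s)‖ + ‖toL2 (u₁ s)‖ + ‖toL2 (u₂ s)‖
      + ‖toL2 (u₃ s)‖ ≤ B := by
    have hc := ((h.continuousOn.norm.add h.continuousOn₁.norm).add
      h.continuousOn₂.norm).add h.continuousOn₃.norm
    obtain ⟨B, hB⟩ := isCompact_Icc.exists_bound_of_continuousOn hc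
    exact ⟨B, fun s hs => (le_abs_self _).trans (hB s hs)⟩
  have hcm : ∀ q, ContinuousOn (fun s => toL2 (diffQuot q fun x => u s x - u₂ s x))
      (Set.Icc 0 b) := fun q =>
    ((((shiftL2 q).continuous.comp_continuousOn h.continuousOn_m).sub
      h.continuousOn_m).const_smul q⁻¹).congr fun s hs =>
        toL2_diffQuot (h.equationAt s hs).hm.1 q
  have hcM : ∀ q, ContinuousOn (fun s => toL2 (diffQuot q fun x => v s x - v₂ s x))
      (Set.Icc 0 b) := fun q =>
    ((((shiftL2 q).continuous.comp_continuousOn h.continuousOn_M).sub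
      h.continuousOn_M).const_smul q⁻¹).congr fun s hs =>
        toL2_diffQuot (h.equationAt s hs).memLp q
  have hdm : ∀ q, ∀ s ∈ Set.Icc 0 b, HasDerivWithinAt
      (fun s => toL2 (diffQuot q fun x => u s x - u₂ s x))
      (toL2 (diffQuot q fun x => v s x - v₂ s x)) (Set.Icc 0 b) s := by
    intro q s hs
    have h1 := (shiftL2 q).toContinuousLinearMap.hasFDerivAt.comp_hasDerivWithinAt s
      (h.hasDeriv_m hs)
    rw [toL2_diffQuot (h.equationAt s hs).memLp q]
    exact ((h1.sub (h.hasDeriv_m hs)).const_smul q⁻¹).congr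
      (fun r hr => toL2_diffQuot (h.equationAt r hr).hm.1 q)
      (toL2_diffQuot (h.equationAt s hs).hm.1 q)
  have hcG : ∀ q, ContinuousOn (fun s => 2 * inner ℝ (toL2 (diffQuot q fun x => u s x - u₂ s x))
      (toL2 (diffQuot q fun x => v s x - v₂ s x))) (Set.Icc 0 t) := fun q =>
    (continuousOn_const.mul ((hcm q).inner (hcM q))).mono hsub
  have hint : ∀ q, ∫ s in (0 : ℝ)..t,
      2 * inner ℝ (toL2 (diffQuot q fun x => u s x - u₂ s x))
        (toL2 (diffQuot q fun x => v s x - v₂ s x))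
      = ‖toL2 (diffQuot q fun x => u t x - u₂ t x)‖ ^ 2
        - ‖toL2 (diffQuot q fun x => u 0 x - u₂ 0 x)‖ ^ 2 := by
    intro q
    refine intervalIntegral.integral_eq_sub_of_hasDeriv_right_of_le
      (f := fun t => ‖toL2 (diffQuot q fun x => u t x - u₂ t x)‖ ^ 2) ht.1
      (((hcm q).norm.pow 2).mono hsub) (fun s hs => ?_)
      ((hcG q).intervalIntegrable_of_Icc ht.1)
    have hs' : s ∈ Set.Ico 0 b := ⟨hs.1.le, hs.2.trans_le ht.2⟩
    exact ((hdm q s (Set.Ico_subset_Icc_self hs')).norm_sq.Ici_of_Icc hs').mono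
      Set.Ioi_subset_Ici_self
  have ht0 : (0 : ℝ) ∈ Set.Icc 0 b := ⟨le_rfl, ht.1.trans ht.2⟩
  have hL : Tendsto (fun q => ∫ s in (0 : ℝ)..t,
      2 * inner ℝ (toL2 (diffQuot q fun x => u s x - u₂ s x))
        (toL2 (diffQuot q fun x => v s x - v₂ s x))) (𝓝[≠] 0)
      (𝓝 (‖toL2 fun x => u₁ t x - u₃ t x‖ ^ 2 - ‖toL2 fun x => u₁ 0 x - u₃ 0 x‖ ^ 2)) := by
    simp only [hint]
    exact ((h.equationAt t ht).hm.tendsto_diffQuot.norm.pow 2).sub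
      ((h.equationAt 0 ht0).hm.tendsto_diffQuot.norm.pow 2)
  have hfin := le_integral_of_tendsto_of_bounded ht.1 hcG (hH.mono hsub)
    (P := fun s => 2 * EquationAt.production lam (u s) (u₁ s) (u₂ s) (u₃ s))
    (fun q s hs => by
      have hs' := hsub hs
      have hBs := hB s hs'
      have n0 := norm_nonneg (toL2 (u s))
      have n1 := norm_nonneg (toL2 (u₁ s))
      have n2 := norm_nonneg (toL2 (u₂ s))
      have n3 := norm_nonneg (toL2 (u₃ s))
      have := (h.equationAt s hs').abs_inner_diffQuot_le (B := B) (by linarith) (by linarith)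
        (by linarith) (by linarith) q
      rw [abs_mul, abs_two]
      exact mul_le_mul_of_nonneg_left this zero_le_two)
    (fun s hs => (h.equationAt s (hsub hs)).tendsto_inner_diffQuot.const_mul 2)
    (fun s hs => hle s (hsub hs)) hL
  linarith

end SolutionCurve

theorem mul_exp_pow (r ρ t : ℝ) (n : ℕ) :
    (r * Real.exp (ρ * t)) ^ n = r ^ n * Real.exp (n * ρ * t) := by
  rw [mul_pow, ← Real.exp_nat_mul]
  ring_nf

theorem add_le_mul_exp_of_sq_add_sq_le {a b Y r c ρ t : ℝ} (hr : 4 * Y ≤ r ^ 2)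
    (hr0 : 0 ≤ r) (hY : 0 ≤ Y) (h : a ^ 2 + b ^ 2 ≤ Y * Real.exp (c * t)) (hc : c ≤ 2 * ρ)
    (ht : 0 ≤ t) : a + b ≤ r * Real.exp (ρ * t) := by
  refine le_of_sq_le_sq ?_ (by positivity)
  have h1 : Real.exp (c * t) ≤ Real.exp ((2 : ℕ) * ρ * t) :=
    Real.exp_le_exp.2 (mul_le_mul_of_nonneg_right (by exact_mod_cast hc) ht)
  rw [mul_exp_pow]
  have h2 := Real.exp_pos ((2 : ℕ) * ρ * t)
  nlinarith [sq_nonneg (a - b), mul_le_mul_of_nonneg_left h1 hY,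
    mul_le_mul_of_nonneg_right hr h2.le]

namespace SolutionCurve

variable {lam k b : ℝ} {u u₁ u₂ u₃ v v₁ v₂ : ℝ → ℝ → ℝ}

theorem norm_m_sq_eq {I : Set ℝ} (h : SolutionCurve lam I u u₁ u₂ u₃ v v₁ v₂) {t : ℝ}
    (ht : t ∈ I) : ‖toL2 fun x => u t x - u₂ t x‖ ^ 2
      = ‖toL2 (u t)‖ ^ 2 + 2 * ‖toL2 (u₁ t)‖ ^ 2 + ‖toL2 (u₂ t)‖ ^ 2 :=
  (h.equationAt t ht).hu.norm_sub_sq (h.equationAt t ht).hu₁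

theorem norm_n_sq_eq {I : Set ℝ} (h : SolutionCurve lam I u u₁ u₂ u₃ v v₁ v₂) {t : ℝ}
    (ht : t ∈ I) : ‖toL2 fun x => u₁ t x - u₃ t x‖ ^ 2
      = ‖toL2 (u₁ t)‖ ^ 2 + 2 * ‖toL2 (u₂ t)‖ ^ 2 + ‖toL2 (u₃ t)‖ ^ 2 :=
  (h.equationAt t ht).hu₁.norm_sub_sq (h.equationAt t ht).hu₂

theorem abs_le_of_energy_le {I : Set ℝ} (h : SolutionCurve lam I u u₁ u₂ u₃ v v₁ v₂) {t A : ℝ}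
    (ht : t ∈ I) (hA : ‖toL2 (u t)‖ + ‖toL2 (u₁ t)‖ ≤ A) : ∀ᵐ x, |u t x| ≤ A := by
  filter_upwards [(h.equationAt t ht).hu.ae_abs_le] with x hx
  exact hx.trans hA

/-- The `L²` norm of `m = u - u_xx` grows at most exponentially. -/
theorem norm_m_sq_le (h : SolutionCurve lam (Set.Icc 0 b) u u₁ u₂ u₃ v v₁ v₂)
    (hk : ∀ t ∈ Set.Icc 0 b, ∀ᵐ x, -k < u₁ t x) {r ρ B K : ℝ} (hr : 1 ≤ r) (hρ : 0 ≤ ρ)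
    (hA : ∀ t ∈ Set.Icc 0 b, ‖toL2 (u t)‖ + ‖toL2 (u₁ t)‖ ≤ r * Real.exp (ρ * t))
    (h0 : ‖toL2 fun x => u 0 x - u₂ 0 x‖ ^ 2 ≤ B) (hK1 : 6 * ρ ≤ K)
    (hK : (2 * |lam| + 3 * k + 3) * B + 12 * r ^ 6 < K * B) :
    (∀ t ∈ Set.Ico 0 b, 2 * inner ℝ (toL2 fun x => u t x - u₂ t x)
        (toL2 fun x => v t x - v₂ t x) ≤ (2 * |lam| + 3 * k + 3)
          * ‖toL2 fun x => u t x - u₂ t x‖ ^ 2 + 12 * r ^ 6 * Real.exp (6 * ρ * t)) ∧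
      ∀ t ∈ Set.Icc 0 b,
        ‖toL2 fun x => u t x - u₂ t x‖ ^ 2 ≤ B * Real.exp (K * t) := by
  have hle : ∀ t ∈ Set.Ico 0 b, 2 * inner ℝ (toL2 fun x => u t x - u₂ t x)
        (toL2 fun x => v t x - v₂ t x) ≤ (2 * |lam| + 3 * k + 3)
          * ‖toL2 fun x => u t x - u₂ t x‖ ^ 2 + 12 * r ^ 6 * Real.exp (6 * ρ * t) := by
    intro t ht
    have ht' := Set.Ico_subset_Icc_self ht
    have h1 := (h.equationAt t ht').inner_le (hk t ht') (h.abs_le_of_energy_le ht' (hA t ht'))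
      (by linarith [hA t ht', norm_nonneg (toL2 (u t))])
    -- With A ≥ 1 lower powers are absorbed: (A + A²)A ≤ 2A³, and 3(2A³)² = 12A⁶.
    have hA1 : 1 ≤ r * Real.exp (ρ * t) :=
      one_le_mul_of_one_le_of_one_le hr (Real.one_le_exp (mul_nonneg hρ ht.1))
    have h6 := mul_exp_pow r ρ t 6
    push_cast at h6
    set A := r * Real.exp (ρ * t)
    have h2 : (A + A ^ 2) * A ≤ 2 * A ^ 3 := by nlinarith [sq_nonneg A]
    have h3 : ((A + A ^ 2) * A) ^ 2 ≤ (2 * A ^ 3) ^ 2 := by gcongr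
    nlinarith
  refine ⟨hle, le_mul_exp_of_deriv_right_le (h.continuousOn_m.norm.pow 2) (fun t ht =>
    (h.hasDeriv_m (Set.Ico_subset_Icc_self ht)).norm_sq.Ici_of_Icc ht) hle h0 (by positivity)
    hK1 hK⟩

theorem production_le_exp (h : SolutionCurve lam (Set.Icc 0 b) u u₁ u₂ u₃ v v₁ v₂)
    (hk : ∀ t ∈ Set.Icc 0 b, ∀ᵐ x, -k < u₁ t x) {r ρ : ℝ} (hr : 1 ≤ r) (hρ : 0 ≤ ρ)
    {t : ℝ} (ht : t ∈ Set.Icc 0 b)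
    (hA : ‖toL2 (u t)‖ + ‖toL2 (u₁ t)‖ ≤ r * Real.exp (ρ * t))
    (hA' : ‖toL2 (u₁ t)‖ + ‖toL2 (u₂ t)‖ ≤ r * Real.exp (ρ * t))
    (hm : ‖toL2 fun x => u t x - u₂ t x‖ ≤ r * Real.exp (ρ * t)) :
    2 * EquationAt.production lam (u t) (u₁ t) (u₂ t) (u₃ t)
      ≤ (2 * |lam| + 5 * k + 3) * ‖toL2 fun x => u₁ t x - u₃ t x‖ ^ 2
        + 77 * r ^ 6 * Real.exp (6 * ρ * t) := by
  refine ((h.equationAt t ht).production_le (hk t ht) (h.abs_le_of_energy_le ht hA)).trans ?_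
  -- Again A ≥ 1 reduces everything to A⁶: 2A³ ≤ 2A⁶ and 3(5A³)² = 75A⁶, together 77A⁶.
  have hA1 : 1 ≤ r * Real.exp (ρ * t) :=
    one_le_mul_of_one_le_of_one_le hr (Real.one_le_exp (mul_nonneg hρ ht.1))
  have h6 := mul_exp_pow r ρ t 6
  push_cast at h6
  set A := r * Real.exp (ρ * t)
  have n1 := norm_nonneg (toL2 (u₁ t))
  have n2 := norm_nonneg (toL2 (u₂ t))
  have h1 : (‖toL2 (u₁ t)‖ + ‖toL2 (u₂ t)‖) * ‖toL2 fun x => u t x - u₂ t x‖ ^ 2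
      ≤ A * A ^ 2 := by gcongr
  have h2 : (1 + 2 * A) * (‖toL2 (u₁ t)‖ + ‖toL2 (u₂ t)‖) * ‖toL2 (u₁ t)‖
      + (A + A ^ 2) * ‖toL2 (u₂ t)‖ ≤ (1 + 2 * A) * A * A + (A + A ^ 2) * A := by
    gcongr <;> linarith
  have h3 : (1 + 2 * A) * A * A + (A + A ^ 2) * A ≤ 5 * A ^ 3 := by nlinarith [sq_nonneg A]
  have h4 : ((1 + 2 * A) * (‖toL2 (u₁ t)‖ + ‖toL2 (u₂ t)‖) * ‖toL2 (u₁ t)‖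
      + (A + A ^ 2) * ‖toL2 (u₂ t)‖) ^ 2 ≤ (5 * A ^ 3) ^ 2 := by
    have := h2.trans h3
    gcongr
  have h5 : A ^ 3 ≤ A ^ 6 := pow_le_pow_right₀ hA1 (by norm_num)
  nlinarith

end SolutionCurve

/-! ### The a priori estimate with an explicit rate -/

/-- The a priori estimate for the squared `H³` norm `‖m‖² + ‖m_x‖²`, with a rate depending only
on the coefficients and on the initial size. -/
theorem exists_rate (lam : ℝ) {k Y : ℝ} (hk : 0 < k) (hY : 0 < Y) :
    ∃ κ > 0, ∀ (b : ℝ) (u u₁ u₂ u₃ v v₁ v₂ : ℝ → ℝ → ℝ), 0 ≤ b →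
      SolutionCurve lam (Set.Icc 0 b) u u₁ u₂ u₃ v v₁ v₂ →
      (∀ t ∈ Set.Icc 0 b, ∀ᵐ x, -k < u₁ t x) →
      ‖toL2 fun x => u 0 x - u₂ 0 x‖ ^ 2 + ‖toL2 fun x => u₁ 0 x - u₃ 0 x‖ ^ 2 = Y →
      ‖toL2 fun x => u b x - u₂ b x‖ ^ 2 + ‖toL2 fun x => u₁ b x - u₃ b x‖ ^ 2
        ≤ Y * Real.exp (κ * b) := by
  set l := |lam| with hl
  have hl0 : 0 ≤ l := abs_nonneg lam
  obtain ⟨r, hr1, hr⟩ : ∃ r : ℝ, 1 ≤ r ∧ 4 * Y ≤ r ^ 2 := ⟨1 + 4 * Y, by linarith, by nlinarith⟩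
  set ρ := 2 * l + 1 with hρ
  set c := 2 * l + 3 * k + 3 with hc
  set c₂ := 2 * l + 5 * k + 3 with hc₂
  -- K is the rate for ‖m‖² and κ the rate for ‖m‖² + ‖m_x‖². Each exceeds the exponent of its
  -- forcing (6ρ, then 6K) and its linear coefficient (c, then c₂). The quotients by Y absorb the
  -- forcing amplitudes, 12r⁶ and 89r⁶ = (12 + 77)r⁶, and the 1 gives strictness.
  set K := 6 * ρ + c + 12 * r ^ 6 / Y + 1 with hK
  set κ := 6 * K + c₂ + 89 * r ^ 6 / Y + 1 with hκ
  have hq : 0 ≤ 12 * r ^ 6 / Y := by positivity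
  have hq' : 0 ≤ 89 * r ^ 6 / Y := by positivity
  refine ⟨κ, by positivity, fun b u u₁ u₂ u₃ v v₁ v₂ hb h hk' h0 => ?_⟩
  have h0b : (0 : ℝ) ∈ Set.Icc 0 b := ⟨le_rfl, hb⟩
  have hbb : b ∈ Set.Icc 0 b := ⟨hb, le_rfl⟩
  have hE0 : ‖toL2 (u 0)‖ ^ 2 + ‖toL2 (u₁ 0)‖ ^ 2 ≤ Y := by
    rw [h.norm_m_sq_eq h0b, h.norm_n_sq_eq h0b] at h0
    nlinarith [sq_nonneg ‖toL2 (u₁ 0)‖, sq_nonneg ‖toL2 (u₂ 0)‖, sq_nonneg ‖toL2 (u₃ 0)‖]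
  have hE := h.energy_le hY hE0
  have hA : ∀ t ∈ Set.Icc 0 b, ‖toL2 (u t)‖ + ‖toL2 (u₁ t)‖ ≤ r * Real.exp (ρ * t) :=
    fun t ht => add_le_mul_exp_of_sq_add_sq_le hr (by linarith) hY.le (hE t ht) (by linarith)
      ht.1
  obtain ⟨hy', hy⟩ := h.norm_m_sq_le hk' hr1 (by positivity) hA
    (by linarith [sq_nonneg ‖toL2 fun x => u₁ 0 x - u₃ 0 x‖] :
      ‖toL2 fun x => u 0 x - u₂ 0 x‖ ^ 2 ≤ Y) (K := K) (by linarith) (by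
      have : 12 * r ^ 6 / Y * Y = 12 * r ^ 6 := div_mul_cancel₀ _ hY.ne'
      nlinarith [mul_nonneg hl0 hY.le])
  have hKρ : ρ ≤ K := by linarith
  have hK0 : 0 ≤ K := by linarith
  have hP : ∀ t ∈ Set.Icc 0 b, 2 * EquationAt.production lam (u t) (u₁ t) (u₂ t) (u₃ t)
      ≤ c₂ * ‖toL2 fun x => u₁ t x - u₃ t x‖ ^ 2 + 77 * r ^ 6 * Real.exp (6 * K * t) := by
    intro t ht
    have hyt := hy t ht
    have hyt' := hyt
    rw [h.norm_m_sq_eq ht] at hyt'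
    -- The bound on ‖m‖² also bounds u₁ and u₂ in L². The exponent K, larger than necessary, serves
    -- for all three norms at once.
    refine h.production_le_exp hk' hr1 hK0 ht ((hA t ht).trans ?_) ?_ ?_
    · exact mul_le_mul_of_nonneg_left
        (Real.exp_le_exp.2 (mul_le_mul_of_nonneg_right hKρ ht.1)) (by linarith)
    · refine add_le_mul_exp_of_sq_add_sq_le hr (by linarith) hY.le (c := K) ?_ (by linarith) ht.1
      nlinarith [sq_nonneg ‖toL2 (u t)‖, sq_nonneg ‖toL2 (u₁ t)‖]
    · have := add_le_mul_exp_of_sq_add_sq_le (a := ‖toL2 fun x => u t x - u₂ t x‖) (b := 0) hr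
        (by linarith) hY.le (c := K) (by simpa using hyt) (by linarith : K ≤ 2 * K) ht.1
      simpa using this
  have hHc : ContinuousOn (fun t => c₂ * ‖toL2 fun x => u₁ t x - u₃ t x‖ ^ 2
      + 77 * r ^ 6 * Real.exp (6 * K * t)) (Set.Icc 0 b) :=
    (continuousOn_const.mul (h.continuousOn_n.norm.pow 2)).add
      (Continuous.continuousOn (by fun_prop))
  have hφ := fun t ht => h.norm_n_sq_le hHc hP (t := t) ht
  set H : ℝ → ℝ := fun t => c₂ * ‖toL2 fun x => u₁ t x - u₃ t x‖ ^ 2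
      + 77 * r ^ 6 * Real.exp (6 * K * t) with hH
  have hHd : ∀ t ∈ Set.Ico 0 b,
      HasDerivWithinAt (fun t => ∫ s in (0 : ℝ)..t, H s) (H t) (Set.Ici t) t := by
    intro t ht
    have ht' := Set.Ico_subset_Icc_self ht
    have hs : Set.Icc 0 b ∈ 𝓝[>] t :=
      mem_of_superset (Icc_mem_nhdsGT ht.2) (Set.Icc_subset_Icc_left ht.1)
    refine intervalIntegral.integral_hasDerivWithinAt_right
      ((hHc.mono (Set.Icc_subset_Icc_right ht'.2)).intervalIntegrable_of_Icc ht.1) ?_ ?_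
    · exact ⟨Set.Icc 0 b, hs, hHc.aestronglyMeasurable measurableSet_Icc⟩
    · exact (hHc t ht').mono_of_mem_nhdsWithin hs
  have hHcont : ContinuousOn (fun t => ∫ s in (0 : ℝ)..t, H s) (Set.Icc 0 b) := by
    have := intervalIntegral.continuousOn_primitive_interval (μ := volume) (f := H) (a := 0)
      (b := b) (by rw [Set.uIcc_of_le hb]; exact hHc.integrableOn_Icc)
    rwa [Set.uIcc_of_le hb] at this
  -- ‖m_x‖² is known only through an integral inequality, so it is replaced by the right-hand side
  -- of that inequality. This majorant is differentiable in time and equals ‖m_x‖² at time 0, so the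
  -- sum starts exactly at Y.
  have hW := le_mul_exp_of_deriv_right_le (b := b) (c := c₂) (β := 89 * r ^ 6) (δ := 6 * K)
    (B := Y) (K := κ)
    (f := fun t => ‖toL2 fun x => u t x - u₂ t x‖ ^ 2
      + (‖toL2 fun x => u₁ 0 x - u₃ 0 x‖ ^ 2 + ∫ s in (0 : ℝ)..t, H s))
    ((h.continuousOn_m.norm.pow 2).add (continuousOn_const.add hHcont))
    (fun t ht => ((h.hasDeriv_m (Set.Ico_subset_Icc_self ht)).norm_sq.Ici_of_Icc ht).add
      ((hHd t ht).const_add _))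
    (fun t ht => by
      have ht' := Set.Ico_subset_Icc_self ht
      have h1 := hy' t ht
      have h2 := hφ t ht'
      have h3 : Real.exp (6 * ρ * t) ≤ Real.exp (6 * K * t) :=
        Real.exp_le_exp.2 (mul_le_mul_of_nonneg_right (by linarith) ht.1)
      have h4 : 12 * r ^ 6 * Real.exp (6 * ρ * t) ≤ 12 * r ^ 6 * Real.exp (6 * K * t) := by
        gcongr
      have hcc : c ≤ c₂ := by linarith
      have hc0 : 0 ≤ c₂ := by positivity
      have h5 := mul_le_mul_of_nonneg_left h2 hc0
      have h6 := mul_le_mul_of_nonneg_right hcc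
        (sq_nonneg ‖toL2 fun x => u t x - u₂ t x‖)
      have h7 : H t = c₂ * ‖toL2 fun x => u₁ t x - u₃ t x‖ ^ 2
        + 77 * r ^ 6 * Real.exp (6 * K * t) := rfl
      rw [h7]
      linarith)
    (by simp [h0]) (by positivity) (by linarith) (by
      have : 89 * r ^ 6 / Y * Y = 89 * r ^ 6 := div_mul_cancel₀ _ hY.ne'
      nlinarith) b hbb
  linarith [hφ b hbb]

/-- The H¹ estimate holds for every B > 0 when the initial energy vanishes; letting B tend to 0
gives u = 0 in L², and the weak derivatives of zero vanish. -/
theorem SolutionCurve.eq_zero {lam b : ℝ} {u u₁ u₂ u₃ v v₁ v₂ : ℝ → ℝ → ℝ}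
    (h : SolutionCurve lam (Set.Icc 0 b) u u₁ u₂ u₃ v v₁ v₂)
    (h0 : ‖toL2 fun x => u 0 x - u₂ 0 x‖ ^ 2 = 0) (hb : 0 ≤ b) :
    ‖toL2 fun x => u b x - u₂ b x‖ ^ 2 + ‖toL2 fun x => u₁ b x - u₃ b x‖ ^ 2 = 0 := by
  have h0b : (0 : ℝ) ∈ Set.Icc 0 b := ⟨le_rfl, hb⟩
  have hbb : b ∈ Set.Icc 0 b := ⟨hb, le_rfl⟩
  have hE0 : ‖toL2 (u 0)‖ ^ 2 + ‖toL2 (u₁ 0)‖ ^ 2 ≤ 0 := by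
    rw [h.norm_m_sq_eq h0b] at h0
    nlinarith [sq_nonneg ‖toL2 (u₁ 0)‖, sq_nonneg ‖toL2 (u₂ 0)‖]
  have h1 : ‖toL2 (u b)‖ ^ 2 + ‖toL2 (u₁ b)‖ ^ 2 ≤ 0 := by
    have h2 : ∀ B > 0, ‖toL2 (u b)‖ ^ 2 + ‖toL2 (u₁ b)‖ ^ 2
        ≤ B * Real.exp ((2 * |lam| + 1) * b) := fun B hB =>
      h.energy_le hB (hE0.trans hB.le) b hbb
    refine le_of_forall_pos_le_add fun ε hε => ?_
    have h3 := Real.exp_pos ((2 * |lam| + 1) * b)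
    have h4 := h2 (ε / Real.exp ((2 * |lam| + 1) * b)) (div_pos hε h3)
    rw [div_mul_cancel₀ _ h3.ne'] at h4
    linarith
  have e0 : toL2 (u b) = 0 := by
    rw [← norm_eq_zero, ← sq_eq_zero_iff]
    nlinarith [sq_nonneg ‖toL2 (u b)‖, sq_nonneg ‖toL2 (u₁ b)‖]
  have e1 := (h.equationAt b hbb).hu.toL2_deriv_eq_zero e0
  have e2 := (h.equationAt b hbb).hu₁.toL2_deriv_eq_zero e1
  have e3 := (h.equationAt b hbb).hu₂.toL2_deriv_eq_zero e2
  rw [h.norm_m_sq_eq hbb, h.norm_n_sq_eq hbb, e0, e1, e2, e3]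
  simp

/-! ### The momentum, the H³ norm and the conclusion -/

/-- The binomial coefficients 1, 3, 3, 1 are the sum of 1, 2, 1, 0 from m and 0, 1, 2, 1 from m_x.
-/
theorem sobolevNorm_three_eq {f : ℝ → ℝ} (hf : MemSobolevH 3 f) :
    sobolevNorm 3 f = √(‖toL2 fun x => f x - weakDeriv^[2] f x‖ ^ 2
      + ‖toL2 fun x => weakDeriv f x - weakDeriv^[3] f x‖ ^ 2) := by
  have h0 := hf.hasL2Deriv
  have h1 := hf.weakDeriv.hasL2Deriv
  have h2 := hf.weakDeriv.weakDeriv.hasL2Deriv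
  have e1 : ‖toL2 fun x => f x - weakDeriv^[2] f x‖ ^ 2 = _ := h0.norm_sub_sq h1
  have e2 : ‖toL2 fun x => weakDeriv f x - weakDeriv^[3] f x‖ ^ 2 = _ := h1.norm_sub_sq h2
  rw [sobolevNorm_eq hf, e1, e2]
  congr 1
  simp only [Finset.sum_range_succ, Finset.sum_range_zero, Function.iterate_succ_apply,
    Function.iterate_zero_apply, Nat.choose]
  push_cast
  ring

theorem sobolevNorm_one_momentum {f : ℝ → ℝ} (hf : MemSobolevH 3 f) :
    sobolevNorm 1 (fun x => f x - weakDeriv^[2] f x) = sobolevNorm 3 f := by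
  have hd : HasL2Deriv (fun x => f x - weakDeriv^[2] f x)
      (fun x => weakDeriv f x - weakDeriv^[3] f x) :=
    hf.hasL2Deriv.sub hf.weakDeriv.weakDeriv.hasL2Deriv
  have hm : MemSobolevH 1 (fun x => f x - weakDeriv^[2] f x) :=
    ⟨hd.1, _, hd.3, hd.2⟩
  rw [sobolevNorm_three_eq hf, sobolevNorm_eq hm]
  congr 1
  rw [Finset.sum_range_succ, Finset.sum_range_one, Function.iterate_zero_apply,
    Function.iterate_one, toL2_congr hd.3.weakDeriv_ae_eq]
  simp

theorem sobolevNorm_congr {n : ℕ} {f g : ℝ → ℝ} (h : f =ᵐ[volume] g) :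
    sobolevNorm n f = sobolevNorm n g := by
  rw [sobolevNorm, sobolevNorm]
  congr 1
  refine Finset.sum_congr rfl fun j _ => ?_
  congr 1
  refine integral_congr_ae ?_
  filter_upwards [iterate_weakDeriv_congr h j] with x hx
  rw [hx]

theorem Icc_subset_timeInterval {T : EReal} {t : ℝ} (ht : t ∈ timeInterval T) :
    Set.Icc 0 t ⊆ timeInterval T := fun _ hs =>
  ⟨hs.1, (EReal.coe_le_coe_iff.2 hs.2).trans_lt ht.2⟩

theorem not_blowsUpInFiniteTime_of_sobolevNorm_le {T : EReal} {u : ℝ → ℝ → ℝ} {κ C : ℝ}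
    (hT : 0 < T) (hκ : 0 < κ) (hC : 0 ≤ C)
    (h : ∀ t ∈ timeInterval T, sobolevNorm 3 (u t) ≤ Real.exp (κ * t) * C) :
    ¬ BlowsUpInFiniteTime T u := by
  rintro ⟨τ, rfl, hlim⟩
  have hτ : 0 < τ := by exact_mod_cast hT
  have hle : limsup (fun t => (sobolevNorm 3 (u t) : EReal)) (𝓝[<] τ)
      ≤ ((Real.exp (κ * τ) * C : ℝ) : EReal) := by
    refine limsup_le_of_le (by isBoundedDefault) ?_
    filter_upwards [Ico_mem_nhdsLT hτ] with t ht
    refine EReal.coe_le_coe_iff.2 ((h t ⟨ht.1, EReal.coe_lt_coe_iff.2 ht.2⟩).trans ?_)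
    have := ht.2.le
    gcongr
  rw [hlim] at hle
  exact absurd hle (not_le.2 (EReal.coe_lt_top _))

theorem theorem1p2 (lam : ℝ) (T : EReal) (u₀ m₀ : ℝ → ℝ) (u : ℝ → ℝ → ℝ) (k : ℝ)
    (hu : IsSolution lam T u₀ u)
    (hm₀ : m₀ = fun x => u₀ x - weakDeriv^[2] u₀ x)
    (hm₀_mem : MemSobolevH 1 m₀)
    (hk : 0 < k)
    (hux : ∀ t ∈ timeInterval T, ∀ᵐ x ∂(volume : Measure ℝ), -k < weakDeriv (u t) x) :
    (∃ κ : ℝ, 0 < κ ∧ ∀ t ∈ timeInterval T,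
      sobolevNorm 3 (u t) ≤ Real.exp (κ * t) * sobolevNorm 1 m₀) ∧
    ¬ BlowsUpInFiniteTime T u := by
  obtain ⟨v, v₁, v₂, hc⟩ := hu.exists_solutionCurve
  have hmem := hu.2.2.1.1
  have h0 : (0 : ℝ) ∈ timeInterval T := ⟨le_rfl, by exact_mod_cast hu.1⟩
  have hm : sobolevNorm 1 m₀ = sobolevNorm 3 (u 0) := by
    rw [← sobolevNorm_one_momentum (hmem 0 h0), hm₀]
    refine sobolevNorm_congr ?_
    filter_upwards [hu.2.1, iterate_weakDeriv_congr hu.2.1 2] with x h1 h2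
    rw [h1, h2]
  have hmain : ∃ κ : ℝ, 0 < κ ∧ ∀ t ∈ timeInterval T,
      sobolevNorm 3 (u t) ≤ Real.exp (κ * t) * sobolevNorm 1 m₀ := by
    set Y := ‖toL2 fun x => u 0 x - weakDeriv^[2] (u 0) x‖ ^ 2
      + ‖toL2 fun x => weakDeriv (u 0) x - weakDeriv^[3] (u 0) x‖ ^ 2 with hY
    have hY0 : 0 ≤ Y := by positivity
    rw [hm, sobolevNorm_three_eq (hmem 0 h0), ← hY]
    -- The rate contains a division by Y, so zero initial data are treated separately; any positive
    -- κ works there.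
    rcases hY0.eq_or_lt with hz | hpos
    · refine ⟨1, one_pos, fun t ht => ?_⟩
      have hct := hc.mono (Icc_subset_timeInterval ht)
      rw [sobolevNorm_three_eq (hmem t ht), hct.eq_zero ?_ ht.1]
      · simp only [Real.sqrt_zero]
        positivity
      · have := sq_nonneg ‖toL2 fun x => u 0 x - weakDeriv^[2] (u 0) x‖
        have := sq_nonneg ‖toL2 fun x => weakDeriv (u 0) x - weakDeriv^[3] (u 0) x‖
        linarith
    · obtain ⟨κ, hκ, hb⟩ := exists_rate lam hk hpos
      -- The rate is halved because the estimate is for the squared norm. It is applied on [0, t]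
      -- for each t with the same κ.
      refine ⟨κ / 2, by positivity, fun t ht => ?_⟩
      have hsub := Icc_subset_timeInterval ht
      have h1 := hb t _ _ _ _ _ _ _ ht.1 (hc.mono hsub) (fun s hs => hux s (hsub hs)) hY.symm
      rw [sobolevNorm_three_eq (hmem t ht)]
      refine (Real.sqrt_le_sqrt h1).trans_eq ?_
      have e : Real.exp (κ * t) = Real.exp (κ / 2 * t) ^ 2 := by
        rw [← Real.exp_nat_mul]; push_cast; ring_nf
      rw [Real.sqrt_mul hY0, e, Real.sqrt_sq (Real.exp_pos _).le, mul_comm]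
  obtain ⟨κ, hκ, h⟩ := hmain
  exact ⟨⟨κ, hκ, h⟩, not_blowsUpInFiniteTime_of_sobolevNorm_le hu.1 hκ (Real.sqrt_nonneg _) h⟩
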